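/- Let $N\ge 1$, $\lambda>1000$, $\varkappa>100$ and $\frac{10}{\lambda}<\theta<\frac1{100}$. Let $\mu=\sum_{k=1}^N\mu_k\delta_{t_k}$ be a probability measure with $t_k>0$, $\mu_k>0$ which is completely lacunary, that is, for $1\le k<N$, $$t_{k+1}>\lambda t_k,\qquad \frac{\mu_{k+1}}{t_{k+1}}>\varkappa\,\frac{\mu_k}{t_k},\qquad \frac{\mu_{k+1}}{t_{k+1}^2}<\theta\,\frac{\mu_k}{t_k^2}.$$ Let $J$ be the $N\times N$ Jacobi matrix with diagonal $q_1,\dots,q_N\in\mathbb R$ and off-diagonal $\rho_1,\dots,\rho_{N-1}>0$ whose spectral data is $\mu$, i.e. $\langle (J-z)^{-1}(1,0,\dots,0)^{\mathsf T},(1,0,\dots,0)^{\mathsf T}\rangle=\sum_{k=1}^N\frac{\mu_k}{t_k-z}$ for $\operatorname{Im}z>0$. A canonical system corresponding to $J$ is given by a locally summable $\mathsf H\colon(0,\infty)\to\mathbb R^{2\times2}$ with $\mathsf H\ge0$ and $\operatorname{tr}\mathsf H=1$ a.e., which consists of $N$ consecutive indivisible intervals of lengths $l_1,\dots,l_N>0$,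 starting at $0$, followed by an infinite one: $\mathsf H=\langle\cdot,e_k\rangle e_k$ on the $k$-th interval ($1\le k\le N+1$, $e_k\in\mathbb R^2$), and none of these intervals can be enlarged so that this still holds a.e. on it. With $e=(e^+,e^-)$, $e^\perp=(-e^-,e^+)$ and $\delta_k=-\langle e_k^\perp,e_{k+1}\rangle$, the correspondence means that $$q_1=\frac1{l_1}\left(\frac{\langle e_1,e_2\rangle}{\langle e_1^\perp,e_2\rangle}-\frac{e_1^-}{e_1^+}\right),\qquad q_j=\frac1{l_j}\left(\frac{\langle e_j,e_{j+1}\rangle}{\langle e_j^\perp,e_{j+1}\rangle}+\frac{\langle e_{j-1},e_j\rangle}{\langle e_{j-1}^\perp,e_j\rangle}\right)\ (2\le j\le N),$$ $$\rho_j=-\frac1{\sqrt{l_{j+1}l_j}\,\langle e_j^\perp,e_{j+1}\rangle}\ (1\le j<N),$$ where the signs of the vectors $e_k$ are chosen so that $\delta_k>0$ for $1\le k\le N$. Then a canonical system corresponding to $J$ with $e_1=(1,0)$ and $l_1=1000/q_1$ exists, and every such system satisfies $\frac1{1001}<\delta_1<\frac1{1000}$ and, for $1\le n\le N-1$, $$\frac{\delta_n}{\delta_{n+1}}>\frac{\varkappa}{10},\qquad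 \frac{l_{n+1}\delta_{n+1}}{l_n\delta_n}>\frac{\lambda}{10},\qquad \frac{l_{n+1}\delta_{n+1}^2}{l_n\delta_n^2}>\frac{1}{1000}\,\theta^{-1}.$$ -/

import Mathlib

/-!
Finite Jacobi matrices, completely lacunary measures and canonical systems made of a chain of
indivisible intervals. All sequences are indexed from `1`, as functions on `ℕ`; only the indices
named in the definitions matter.
-/

noncomputable section

/-- The measure `∑_{k=1}^N m k • δ_{t k}`, with positive masses `m k` and positive nodes `t k`, is
completely lacunary with parameters `lam`, `ϰ`, `θ`. -/
structure CompletelyLacunary (N : ℕ) (lam ϰ θ : ℝ) (t m : ℕ → ℝ) : Prop where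
  node_pos : ∀ k, 1 ≤ k → k ≤ N → 0 < t k
  mass_pos : ∀ k, 1 ≤ k → k ≤ N → 0 < m k
  node_growth : ∀ k, 1 ≤ k → k < N → t (k + 1) > lam * t k
  ratio_growth : ∀ k, 1 ≤ k → k < N → m (k + 1) / t (k + 1) > ϰ * (m k / t k)
  ratio_decay : ∀ k, 1 ≤ k → k < N → m (k + 1) / t (k + 1) ^ 2 < θ * (m k / t k ^ 2)

/-- The `N × N` Jacobi matrix with diagonal `q 1, …, q N` and off-diagonal `ρ 1, …, ρ (N - 1)`. -/
def jacobiMatrix (N : ℕ) (q ρ : ℕ → ℝ) : Matrix (Fin N) (Fin N) ℝ :=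
  Matrix.of fun i j =>
    if (i : ℕ) = j then q (i + 1)
    else if (i : ℕ) + 1 = j then ρ (i + 1)
    else if (j : ℕ) + 1 = i then ρ (j + 1)
    else 0

/-- The Herglotz function `⟨(J - z)⁻¹ e₁, e₁⟩` of a square matrix `J`. -/
def herglotz {N : ℕ} [NeZero N] (J : Matrix (Fin N) (Fin N) ℝ) (z : ℂ) : ℂ :=
  (J.map (fun x : ℝ => (x : ℂ)) - z • (1 : Matrix (Fin N) (Fin N) ℂ))⁻¹ 0 0

/-- `q 1, …, q N` and `ρ 1, …, ρ (N - 1) > 0` are the entries of a Jacobi matrix whose spectral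
data is the probability measure `∑_{k=1}^N m k • δ_{t k}`. -/
structure IsJacobiOf (N : ℕ) [NeZero N] (t m q ρ : ℕ → ℝ) : Prop where
  offdiag_pos : ∀ j, 1 ≤ j → j < N → 0 < ρ j
  total_mass : ∑ k ∈ Finset.Icc 1 N, m k = 1
  spectral : ∀ z : ℂ, 0 < z.im →
    herglotz (jacobiMatrix N q ρ) z = ∑ k ∈ Finset.Icc 1 N, (m k : ℂ) / ((t k : ℂ) - z)

/-- The plane `ℝ²`; the coordinates of `e = (e⁺, e⁻)` are `e 0` and `e 1`. -/
abbrev Plane : Type := EuclideanSpace ℝ (Fin 2)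

/-- Rotation by a right angle, `e^⊥ = (-e⁻, e⁺)`, that is, the matrix
`(0, -1; 1, 0)` of the canonical system applied to `e`. -/
def perp (e : Plane) : Plane := !₂[-e 1, e 0]

/-- The matrix of the operator `⟨·, e⟩ e`. -/
def rankOne (e : Plane) : Matrix (Fin 2) (Fin 2) ℝ := Matrix.of fun i j => e i * e j

/-- A trace-normed Hamiltonian on the half-line `(0, ∞)`. -/
structure IsHamiltonian (H : ℝ → Matrix (Fin 2) (Fin 2) ℝ) : Prop where
  locally_summable : ∀ i j,
    MeasureTheory.LocallyIntegrableOn (fun x => H x i j) (Set.Ioi 0) MeasureTheory.volume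
  nonneg : ∀ᵐ x ∂(MeasureTheory.volume.restrict (Set.Ioi (0 : ℝ))), (H x).PosSemidef
  trace_one : ∀ᵐ x ∂(MeasureTheory.volume.restrict (Set.Ioi (0 : ℝ))), (H x).trace = 1

/-- The open interval `I ⊆ (0, ∞)` is an indivisible interval of `H`, with direction `e`:
`H = ⟨·, e⟩ e` on `I`, and this holds almost everywhere on no larger interval. -/
structure IsIndivisible (H : ℝ → Matrix (Fin 2) (Fin 2) ℝ) (I : Set ℝ) (e : Plane) : Prop where
  nonempty : I.Nonempty
  isOpen : IsOpen I
  ordConnected : I.OrdConnected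
  subset : I ⊆ Set.Ioi 0
  eq_rankOne : ∀ x ∈ I, H x = rankOne e
  maximal : ∀ I' : Set ℝ, IsOpen I' → I'.OrdConnected → I' ⊆ Set.Ioi 0 → I ⊆ I' →
    (∀ᵐ x ∂(MeasureTheory.volume.restrict I'), H x = rankOne e) → I' = I

/-- The Hamiltonian `H` on `(0, ∞)` consists of `N` consecutive indivisible intervals of lengths
`l 1, …, l N` and directions `e 1, …, e N`, followed by an infinite one of direction `e (N + 1)`. -/
structure IsIndivisibleChain (N : ℕ) (H : ℝ → Matrix (Fin 2) (Fin 2) ℝ) (l : ℕ → ℝ)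
    (e : ℕ → Plane) : Prop where
  hamiltonian : IsHamiltonian H
  length_pos : ∀ k, 1 ≤ k → k ≤ N → 0 < l k
  interval : ∀ k, 1 ≤ k → k ≤ N →
    IsIndivisible H
      (Set.Ioo (∑ i ∈ Finset.Icc 1 (k - 1), l i) (∑ i ∈ Finset.Icc 1 k, l i)) (e k)
  last : IsIndivisible H (Set.Ioi (∑ i ∈ Finset.Icc 1 N, l i)) (e (N + 1))

/-- `δ_k = -⟨e_k^⊥, e_{k+1}⟩`. -/
def chainDelta (e : ℕ → Plane) (k : ℕ) : ℝ := -inner ℝ (perp (e k)) (e (k + 1))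

/-- `⟨e_k, e_{k+1}⟩ / ⟨e_k^⊥, e_{k+1}⟩`. -/
def chainCot (e : ℕ → Plane) (k : ℕ) : ℝ :=
  inner ℝ (e k) (e (k + 1)) / inner ℝ (perp (e k)) (e (k + 1))

/-- The relations saying that the `N × N` Jacobi matrix with entries `q`, `ρ` corresponds to the
chain with lengths `l` and directions `e`. A direction is determined by the Hamiltonian up to sign;
the signs are chosen so that every `δ_k` is positive. For `k < N` this is forced by the formula
for `ρ_k > 0`; for `k = N` it fixes the sign of `e (N + 1)`. -/
structure Corresponds (N : ℕ) (q ρ l : ℕ → ℝ) (e : ℕ → Plane) : Prop where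
  diag_one : q 1 = 1 / l 1 * (chainCot e 1 - e 1 1 / e 1 0)
  diag : ∀ j, 2 ≤ j → j ≤ N → q j = 1 / l j * (chainCot e j + chainCot e (j - 1))
  offdiag : ∀ j, 1 ≤ j → j < N →
    ρ j = -(1 / (Real.sqrt (l (j + 1) * l j) * inner ℝ (perp (e j)) (e (j + 1))))
  sign : ∀ k, 1 ≤ k → k ≤ N → 0 < chainDelta e k

/-- `H`, with lengths `l` and directions `e`, is a canonical system corresponding to the `N × N`
Jacobi matrix with entries `q`, `ρ`, normalised by `e_1 = (1, 0)` and `l_1 = 1000 / q_1`. -/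
structure IsCanonicalSystemOf (N : ℕ) (q ρ : ℕ → ℝ) (H : ℝ → Matrix (Fin 2) (Fin 2) ℝ)
    (l : ℕ → ℝ) (e : ℕ → Plane) : Prop where
  chain : IsIndivisibleChain N H l e
  corresponds : Corresponds N q ρ l e
  direction_one : e 1 = !₂[1, 0]
  length_one : l 1 = 1000 / q 1

end

open Polynomial Filter Topology

/-! Let `P_j`, of degree `j - 1`, be the orthonormal polynomials of the measure. The matrix `J` is
also described by a Stieltjes string with masses `P_j(0)²` and gaps `g_j = -1/(ρ_j P_j(0)
P_{j+1}(0))`, which are positive because all nodes are. In a corresponding canonical system both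
coordinates of `√l_j e_j` solve the recurrence of `J` at `0`. With `e_1 = (1, 0)` this gives `√l_j
e_j⁺ = √l_1 P_j(0)` and `l_1 e_j⁻ / e_j⁺ = g_1 + ... + g_{j-1}` (`rootLength_mul_fst`,
`rootLength_mul_snd`). The whole string has length about `m_N / t_N ≤ 1 / q_1 = l_1 / 1000`, so
every `e_j` is nearly horizontal. Hence `l_j ≈ l_1 P_j(0)²` and `δ_j = 1 / (ρ_j √(l_j l_{j+1})) ≈
g_j / l_1`.

The string is computed from an extremal problem: minimise `∑ w_k p(t_k)²` over `deg p ≤ d`, `p(0) =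
1`. For `w = m` the minimum is the reciprocal of the reproducing kernel at `(0, 0)`, for `w = m / t`
it is `stringRest`, the distance from the mass number `d + 1` to the end of the string. If `t` and
`w` grow fast, the minimum is close to `w_{N-d}` (`reproducing_norm_bounds`): `p` can vanish at the
`d` largest nodes, and the node `N - d` dominates the rest. Differences in `d` give `g_{n+1} ≈
m_{N-n} / t_{N-n}` and `P_{n+1}(0)² ≈ 1 / m_{N-n}`.

So `δ_{n+1}`, `l_{n+1} δ_{n+1}` and `l_{n+1} δ_{n+1}²` are, up to factors near `1` and powers of
`l_1`, the numbers `m/t`, `1/t` and `m/t²` at the node `N - n`, and the three lacunarity conditions,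
read in reverse order, are the three conclusions. The angle `δ_1` is computed exactly. Existence
follows by building the chain from two solutions of the recurrence with Wronskian `1`. -/

/-- The off-diagonal entries of a Jacobi matrix of size `N`, extended by `1`. -/
def extendByOne (N : ℕ) (ρ : ℕ → ℝ) (j : ℕ) : ℝ := if 1 ≤ j ∧ j < N then ρ j else 1

/-- The polynomials of the first kind attached to Jacobi parameters, with `orthoPoly q r 0 = 0` and
`orthoPoly q r (j + 1)` of degree `j`. -/
noncomputable def orthoPoly (q r : ℕ → ℝ) : ℕ → ℝ[X]
  | 0 => 0
  | 1 => 1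
  | n + 2 => C (r (n + 1))⁻¹ *
      ((X - C (q (n + 1))) * orthoPoly q r (n + 1) - C (r n) * orthoPoly q r n)

/-! ### Moments from the behaviour of the resolvent at infinity -/

/-- With `w = 1/z` the resolvent is `w (wA - 1)⁻¹`, and `(wA - 1)⁻¹`, written as adjugate over
determinant, is continuous at `w = 0`. -/
theorem tendsto_resolvent_entry {n : Type*} [Fintype n] [DecidableEq n] (A B : Matrix n n ℂ)
    (i j : n) :
    Tendsto (fun y : ℝ => (B * (A - (y * Complex.I : ℂ) • (1 : Matrix n n ℂ))⁻¹) i j) atTop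
      (𝓝 0) := by
  have hw : Tendsto (fun y : ℝ => ((y * Complex.I : ℂ))⁻¹) atTop (𝓝 0) := by
    rw [tendsto_zero_iff_norm_tendsto_zero]
    have : (fun y : ℝ => ‖((y * Complex.I : ℂ))⁻¹‖) = fun y : ℝ => |y|⁻¹ := by
      ext y; simp
    rw [this]
    exact tendsto_inv_atTop_zero.comp tendsto_abs_atTop_atTop
  have hc : ContinuousAt (fun w : ℂ =>
      (-w) * (B * ((w • A - 1).det⁻¹ • (-(w • A - 1).adjugate))) i j) 0 := by
    have h1 : Continuous fun w : ℂ => w • A - 1 := by fun_prop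
    have h2 : ContinuousAt (fun w : ℂ => (w • A - 1).det⁻¹) 0 := by
      apply ContinuousAt.inv₀ h1.matrix_det.continuousAt
      simp [Matrix.det_neg]
    have h3 : ContinuousAt (fun w : ℂ => -(w • A - 1).adjugate) 0 :=
      h1.matrix_adjugate.neg.continuousAt
    have h4 : ContinuousAt
        (fun w : ℂ => B * ((w • A - 1).det⁻¹ • (-(w • A - 1).adjugate))) 0 :=
      continuousAt_const.mul (h2.smul h3)
    have h5 : ContinuousAt
        (fun w : ℂ => (B * ((w • A - 1).det⁻¹ • (-(w • A - 1).adjugate))) i j) 0 :=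
      ((continuous_apply_apply i j).continuousAt).comp h4
    exact continuousAt_id.neg.mul h5
  have h := hc.tendsto.comp hw
  simp only [neg_zero, zero_mul] at h
  refine h.congr' ?_
  filter_upwards [eventually_gt_atTop 0] with y hy
  have hz : (y * Complex.I : ℂ) ≠ 0 := by
    simp [hy.ne']
  set z : ℂ := y * Complex.I
  have e1 : A - z • (1 : Matrix n n ℂ) = z • (z⁻¹ • A - 1) := by
    rw [smul_sub, smul_smul, mul_inv_cancel₀ hz, one_smul]
  have e2 : (A - z • (1 : Matrix n n ℂ))⁻¹ = z⁻¹ • (z⁻¹ • A - 1)⁻¹ := by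
    rw [e1]
    by_cases hd : (z⁻¹ • A - 1).det = 0
    · rw [Matrix.inv_def, Matrix.inv_def, Matrix.det_smul, hd]
      simp
    · have : Invertible z := invertibleOfNonzero hz
      rw [Matrix.inv_smul _ z (isUnit_iff_ne_zero.2 hd), invOf_eq_inv]
  rw [e2, Matrix.inv_def, Ring.inverse_eq_inv']
  change -z⁻¹ * (B * ((z⁻¹ • A - 1).det⁻¹ • (-(z⁻¹ • A - 1).adjugate))) i j = _
  clear_value z
  simp

theorem eventually_isUnit_det_sub_smul {n : Type*} [Fintype n] [DecidableEq n]
    (A : Matrix n n ℂ) :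
    ∀ᶠ y : ℝ in atTop, IsUnit (A - (y * Complex.I : ℂ) • (1 : Matrix n n ℂ)).det := by
  have hfin : ((fun y : ℝ => (y * Complex.I : ℂ)) ⁻¹' {z | A.charpoly.IsRoot z}).Finite := by
    apply Set.Finite.preimage
    · intro a _ b _ hab
      simpa using hab
    · exact Polynomial.finite_setOfPred_isRoot (Matrix.charpoly_monic A).ne_zero
  have := hfin.compl_mem_cofinite
  have h2 : ∀ᶠ y : ℝ in atTop, y ∉ ((fun y : ℝ => (y * Complex.I : ℂ)) ⁻¹'
      {z | A.charpoly.IsRoot z}) := atTop_le_cofinite this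
  filter_upwards [h2] with y hy
  rw [isUnit_iff_ne_zero]
  intro h0
  apply hy
  simp only [Set.mem_preimage, Set.mem_ofPred_eq, Polynomial.IsRoot.def, Matrix.eval_charpoly]
  rw [← neg_sub, Matrix.det_neg]
  rw [show Matrix.scalar n (y * Complex.I : ℂ) = (y * Complex.I : ℂ) • (1 : Matrix n n ℂ) by
    rw [Matrix.scalar_apply, Matrix.smul_one_eq_diagonal], h0, mul_zero]

/-- Let `z = iy` with `y → ∞`. Since `A (A - z)⁻¹ = 1 + z (A - z)⁻¹`, equality of `(Aⁿ (A - z)⁻¹)₀₀`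
with `∑ m tⁿ / (t - z)` turns the difference of the `n`-th moments into the same difference of tails
for `n + 1`. It is constant and tends to `0`, so the moments agree and the equality passes to `n +
1`. -/
theorem moment_eq_of_herglotz {N : ℕ} [NeZero N] (J : Matrix (Fin N) (Fin N) ℝ) (t m : ℕ → ℝ)
    (hJ : ∀ z : ℂ, 0 < z.im →
      herglotz J z = ∑ k ∈ Finset.Icc 1 N, (m k : ℂ) / ((t k : ℂ) - z)) (n : ℕ) :
    ∑ k ∈ Finset.Icc 1 N, m k * t k ^ n = (J ^ n) 0 0 := by
  set A : Matrix (Fin N) (Fin N) ℂ := J.map (fun x : ℝ => (x : ℂ)) with hA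
  have hpow : ∀ n, (A ^ n) 0 0 = (((J ^ n) 0 0 : ℝ) : ℂ) := by
    intro n
    have : A ^ n = (J ^ n).map (Complex.ofRealHom) :=
      (Matrix.map_pow J Complex.ofRealHom n).symm
    rw [this]; rfl
  have hG : ∀ n : ℕ, Tendsto (fun y : ℝ => ∑ k ∈ Finset.Icc 1 N,
      (m k : ℂ) * (t k : ℂ) ^ n / ((t k : ℂ) - y * Complex.I)) atTop (𝓝 0) := by
    intro n
    rw [show (0 : ℂ) = ∑ k ∈ Finset.Icc 1 N, (m k : ℂ) * (t k : ℂ) ^ n * 0 by simp]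
    refine tendsto_finsetSum _ fun k _ => ?_
    simp_rw [div_eq_mul_inv]
    refine Tendsto.const_mul _ ?_
    -- A simple fraction is the resolvent of a `1 × 1` matrix.
    have := tendsto_resolvent_entry (n := Fin 1) (Matrix.of fun _ _ => (t k : ℂ)) 1 0 0
    refine this.congr fun y => ?_
    simp
  have key : ∀ n : ℕ, ∀ᶠ y : ℝ in atTop,
      (A ^ n * (A - (y * Complex.I : ℂ) • (1 : Matrix (Fin N) (Fin N) ℂ))⁻¹) 0 0 =
        ∑ k ∈ Finset.Icc 1 N, (m k : ℂ) * (t k : ℂ) ^ n / ((t k : ℂ) - y * Complex.I) →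
      ((A ^ n) 0 0 - ∑ k ∈ Finset.Icc 1 N, (m k : ℂ) * (t k : ℂ) ^ n =
      (A ^ (n + 1) * (A - (y * Complex.I : ℂ) • (1 : Matrix (Fin N) (Fin N) ℂ))⁻¹) 0 0 -
        ∑ k ∈ Finset.Icc 1 N,
          (m k : ℂ) * (t k : ℂ) ^ (n + 1) / ((t k : ℂ) - y * Complex.I)) := by
    intro n
    filter_upwards [eventually_isUnit_det_sub_smul A, eventually_gt_atTop 0] with y hy hy0 he
    set z : ℂ := y * Complex.I with hz
    have h1 : A ^ (n + 1) * (A - z • (1 : Matrix (Fin N) (Fin N) ℂ))⁻¹ =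
        A ^ n + z • (A ^ n * (A - z • (1 : Matrix (Fin N) (Fin N) ℂ))⁻¹) := by
      have : A = (A - z • (1 : Matrix (Fin N) (Fin N) ℂ)) + z • 1 := by simp
      rw [pow_succ, mul_assoc]
      nth_rewrite 2 [this]
      rw [add_mul, Matrix.mul_nonsing_inv _ hy]
      simp [mul_add]
    have h2 : ∑ k ∈ Finset.Icc 1 N, (m k : ℂ) * (t k : ℂ) ^ (n + 1) / ((t k : ℂ) - z) =
        ∑ k ∈ Finset.Icc 1 N, (m k : ℂ) * (t k : ℂ) ^ n +
        z * ∑ k ∈ Finset.Icc 1 N, (m k : ℂ) * (t k : ℂ) ^ n / ((t k : ℂ) - z) := by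
      rw [Finset.mul_sum, ← Finset.sum_add_distrib]
      refine Finset.sum_congr rfl fun k _ => ?_
      have : (t k : ℂ) - z ≠ 0 := by
        intro h
        have := congrArg Complex.im h
        simp [hz] at this
        exact hy0.ne' this
      field_simp
      ring
    rw [h1, h2, ← he]
    simp
  have all : ∀ n : ℕ, ∀ᶠ y : ℝ in atTop,
      (A ^ n * (A - (y * Complex.I : ℂ) • (1 : Matrix (Fin N) (Fin N) ℂ))⁻¹) 0 0 =
        ∑ k ∈ Finset.Icc 1 N, (m k : ℂ) * (t k : ℂ) ^ n / ((t k : ℂ) - y * Complex.I) ∧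
      (A ^ n) 0 0 - ∑ k ∈ Finset.Icc 1 N, (m k : ℂ) * (t k : ℂ) ^ n = 0 := by
    have step : ∀ n : ℕ, (∀ᶠ y : ℝ in atTop,
        (A ^ n * (A - (y * Complex.I : ℂ) • (1 : Matrix (Fin N) (Fin N) ℂ))⁻¹) 0 0 =
        ∑ k ∈ Finset.Icc 1 N, (m k : ℂ) * (t k : ℂ) ^ n / ((t k : ℂ) - y * Complex.I)) →
        (A ^ n) 0 0 - ∑ k ∈ Finset.Icc 1 N, (m k : ℂ) * (t k : ℂ) ^ n = 0 := by
      intro n hn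
      have h1 := (tendsto_resolvent_entry A (A ^ (n + 1)) 0 0).sub (hG (n + 1))
      rw [sub_zero] at h1
      refine tendsto_nhds_unique (tendsto_const_nhds (f := (atTop : Filter ℝ))) (h1.congr' ?_)
      filter_upwards [key n, hn] with y hy hy2
      exact (hy hy2).symm
    intro n
    induction n with
    | zero =>
      have h0 : ∀ᶠ y : ℝ in atTop,
        (A ^ 0 * (A - (y * Complex.I : ℂ) • (1 : Matrix (Fin N) (Fin N) ℂ))⁻¹) 0 0 =
        ∑ k ∈ Finset.Icc 1 N, (m k : ℂ) * (t k : ℂ) ^ 0 / ((t k : ℂ) - y * Complex.I) := by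
        filter_upwards [eventually_gt_atTop 0] with y hy
        have := hJ (y * Complex.I) (by simpa using hy)
        simpa [herglotz] using this
      filter_upwards [h0] with y hy
      exact ⟨hy, step 0 h0⟩
    | succ n ih =>
      have h0 : ∀ᶠ y : ℝ in atTop,
        (A ^ (n + 1) * (A - (y * Complex.I : ℂ) • (1 : Matrix (Fin N) (Fin N) ℂ))⁻¹) 0 0 =
        ∑ k ∈ Finset.Icc 1 N,
          (m k : ℂ) * (t k : ℂ) ^ (n + 1) / ((t k : ℂ) - y * Complex.I) := by
        filter_upwards [key n, ih] with y hy hy2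
        have := hy hy2.1
        rw [hy2.2] at this
        exact (sub_eq_zero.1 this.symm)
      filter_upwards [h0] with y hy
      exact ⟨hy, step _ h0⟩
  obtain ⟨y, _, hy⟩ := (all n).exists
  rw [hpow, sub_eq_zero] at hy
  have : (((J ^ n) 0 0 : ℝ) : ℂ) = ((∑ k ∈ Finset.Icc 1 N, m k * t k ^ n : ℝ) : ℂ) := by
    rw [hy]; push_cast; rfl
  exact (Complex.ofReal_injective this).symm

/-! ### Orthonormality of the polynomials of the first kind -/

theorem sum_eval_eq_aeval {N : ℕ} [NeZero N] (J : Matrix (Fin N) (Fin N) ℝ) (t m : ℕ → ℝ)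
    (hJ : ∀ n : ℕ, ∑ k ∈ Finset.Icc 1 N, m k * t k ^ n = (J ^ n) 0 0) (p : ℝ[X]) :
    ∑ k ∈ Finset.Icc 1 N, m k * p.eval (t k) = (aeval J p) 0 0 := by
  induction p using Polynomial.induction_on' with
  | add p q hp hq => simp [mul_add, Finset.sum_add_distrib, hp, hq]
  | monomial n a =>
    simp only [eval_monomial, aeval_monomial, ← Algebra.smul_def, Matrix.smul_apply, smul_eq_mul,
      ← hJ, Finset.mul_sum]
    exact Finset.sum_congr rfl fun k _ => by ring

theorem jacobiMatrix_isSymm (N : ℕ) (q ρ : ℕ → ℝ) : (jacobiMatrix N q ρ).IsSymm := by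
  ext i j
  simp only [jacobiMatrix, Matrix.transpose_apply, Matrix.of_apply]
  split_ifs <;> first | rfl | omega | (congr 1; omega)

theorem extendByOne_pos {N : ℕ} {ρ : ℕ → ℝ} (hρ : ∀ j, 1 ≤ j → j < N → 0 < ρ j) (j : ℕ) :
    0 < extendByOne N ρ j := by
  unfold extendByOne
  split_ifs with h
  · exact hρ j h.1 h.2
  · exact one_pos

theorem extendByOne_of_lt {N : ℕ} {ρ : ℕ → ℝ} {j : ℕ} (h1 : 1 ≤ j) (h2 : j < N) :
    extendByOne N ρ j = ρ j := by
  simp [extendByOne, h1, h2]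

theorem jacobiMatrix_mulVec_unit (N : ℕ) (q ρ : ℕ → ℝ) (j : ℕ) (hj : j < N) (k : Fin N) :
    (jacobiMatrix N q ρ).mulVec (fun i : Fin N => if (i : ℕ) + 1 = j + 1 then (1 : ℝ) else 0) k =
      extendByOne N ρ (j + 1) * (if (k : ℕ) + 1 = j + 2 then 1 else 0) +
      q (j + 1) * (if (k : ℕ) + 1 = j + 1 then 1 else 0) +
      extendByOne N ρ j * (if (k : ℕ) + 1 = j then 1 else 0) := by
  have h : (jacobiMatrix N q ρ).mulVec (fun i : Fin N => if (i : ℕ) + 1 = j + 1 then (1 : ℝ) else 0) k =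
      jacobiMatrix N q ρ k ⟨j, hj⟩ := by
    rw [Matrix.mulVec, dotProduct, Finset.sum_eq_single ⟨j, hj⟩]
    · simp
    · intro b _ hb
      have : (b : ℕ) ≠ j := fun h => hb (Fin.ext h)
      simp [this]
    · simp
  rw [h]
  simp only [jacobiMatrix, Matrix.of_apply, extendByOne]
  have hk := k.2
  split_ifs <;> first | omega | simp_all

/-- The three-term recurrence is the action of `J` on the standard basis, so the polynomial of
degree `j` carries the first basis vector to the one numbered `j + 1`. For `j = N` no coordinate
qualifies and the vector is `0`; the artificial `ρ_N = 1` only scales that last polynomial. -/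
theorem aeval_orthoPoly_mulVec {N : ℕ} [NeZero N] {q ρ : ℕ → ℝ}
    (hρ : ∀ j, 1 ≤ j → j < N → 0 < ρ j) (j : ℕ) (hj : j ≤ N) :
    ((aeval (jacobiMatrix N q ρ) (orthoPoly q (extendByOne N ρ) (j + 1))).mulVec
      (fun i : Fin N => if (i : ℕ) + 1 = 1 then (1 : ℝ) else 0) =
      fun i : Fin N => if (i : ℕ) + 1 = j + 1 then (1 : ℝ) else 0) ∧
    ((aeval (jacobiMatrix N q ρ) (orthoPoly q (extendByOne N ρ) j)).mulVec
      (fun i : Fin N => if (i : ℕ) + 1 = 1 then (1 : ℝ) else 0) =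
      fun i : Fin N => if (i : ℕ) + 1 = j then (1 : ℝ) else 0) := by
  induction j with
  | zero =>
    refine ⟨?_, ?_⟩
    · simp [orthoPoly]
    · simp [orthoPoly]; rfl
  | succ j ih =>
    obtain ⟨h1, h2⟩ := ih (by omega)
    refine ⟨?_, h1⟩
    rw [orthoPoly]
    simp only [map_mul, map_sub, aeval_X, aeval_C]
    simp only [Algebra.algebraMap_eq_smul_one, smul_mul_assoc, one_mul, Matrix.smul_mulVec,
      Matrix.sub_mulVec, sub_mul, ← Matrix.mulVec_mulVec, h1, h2]
    ext k
    have := jacobiMatrix_mulVec_unit N q ρ j (by omega) k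
    simp only [Pi.smul_apply, Pi.sub_apply, smul_eq_mul, this]
    have hr := (extendByOne_pos hρ (j + 1)).ne'
    field_simp
    ring

/-- Orthonormality, on the nodes `t 1, …, t N` with masses `m 1, …, m N`, of the polynomials of the
first kind. -/
structure IsOrthoSystem (N : ℕ) (t m q r : ℕ → ℝ) : Prop where
  offdiag_pos : ∀ j, 0 < r j
  orthonormal : ∀ i j, 1 ≤ i → i ≤ N → 1 ≤ j → j ≤ N →
    ∑ k ∈ Finset.Icc 1 N, m k * ((orthoPoly q r i).eval (t k) * (orthoPoly q r j).eval (t k)) =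
      if i = j then 1 else 0
  vanish : ∀ k ∈ Finset.Icc 1 N, (orthoPoly q r (N + 1)).eval (t k) = 0

/-- As `J` is symmetric, `∑ m P_i P_j` is the inner product of `P_i(J)` and `P_j(J)` applied to the
first basis vector, that is, of two basis vectors. For `i = j = N + 1` it is `0`, which forces
`P_{N+1}` to vanish at every node because the masses are positive. -/
theorem IsJacobiOf.isOrthoSystem {N : ℕ} [NeZero N] {t m q ρ : ℕ → ℝ}
    (h : IsJacobiOf N t m q ρ) (hm : ∀ k, 1 ≤ k → k ≤ N → 0 < m k) :
    IsOrthoSystem N t m q (extendByOne N ρ) := by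
  set J := jacobiMatrix N q ρ
  set P := orthoPoly q (extendByOne N ρ)
  have hE := sum_eval_eq_aeval J t m (moment_eq_of_herglotz J t m h.spectral)
  have hcol : ∀ j, 1 ≤ j → j ≤ N + 1 → ∀ i, (aeval J (P j)) i 0 = if (i : ℕ) + 1 = j then 1 else 0
      := by
    intro j h1 h2 i
    obtain ⟨j, rfl⟩ := Nat.exists_eq_add_of_le' h1
    have := congrFun (aeval_orthoPoly_mulVec (q := q) h.offdiag_pos j (by omega)).1 i
    rw [← this, Matrix.mulVec, dotProduct, Finset.sum_eq_single 0]
    · simp [J, P]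
    · intro b _ hb
      have : (b : ℕ) ≠ 0 := fun h => hb (Fin.ext h)
      simp [this]
    · simp
  have hrow : ∀ p : ℝ[X], ∀ i j, (aeval J p) i j = (aeval J p) j i := by
    intro p i j
    have hT : (aeval J p).transpose = aeval J p := by
      induction p using Polynomial.induction_on' with
      | add p q hp hq => simp [hp, hq]
      | monomial n a =>
        simp only [aeval_monomial, ← Algebra.smul_def, Matrix.transpose_smul, Matrix.transpose_pow]
        rw [(jacobiMatrix_isSymm N q ρ).eq]
    conv_lhs => rw [← hT]
    rfl
  have hprod : ∀ i j, 1 ≤ i → i ≤ N + 1 → 1 ≤ j → j ≤ N + 1 →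
      ∑ k ∈ Finset.Icc 1 N, m k * ((P i).eval (t k) * (P j).eval (t k)) =
      ∑ k : Fin N, (if (k : ℕ) + 1 = i then 1 else 0) * (if (k : ℕ) + 1 = j then 1 else 0) := by
    intro i j hi hi' hj hj'
    have := hE (P i * P j)
    simp only [eval_mul, map_mul, Matrix.mul_apply] at this
    rw [this]
    refine Finset.sum_congr rfl fun k _ => ?_
    rw [hrow, hcol i hi hi', hcol j hj hj']
  refine ⟨extendByOne_pos h.offdiag_pos, ?_, ?_⟩
  · intro i j hi hi' hj hj'
    rw [hprod i j hi (by omega) hj (by omega)]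
    rw [Finset.sum_eq_single ⟨i - 1, by omega⟩]
    · have : i - 1 + 1 = i := by omega
      simp [this]
    · intro b _ hb
      have : (b : ℕ) + 1 ≠ i := fun h => hb (Fin.ext (by simp; omega))
      simp [this]
    · simp
  · have h0 := hprod (N + 1) (N + 1) (by omega) le_rfl (by omega) le_rfl
    rw [Finset.sum_eq_zero (s := Finset.univ) (fun k _ => by simp [k.2.ne])] at h0
    rw [Finset.sum_eq_zero_iff_of_nonneg] at h0
    · intro k hk
      have := h0 k hk
      have hk' := Finset.mem_Icc.1 hk
      simpa [(hm k hk'.1 hk'.2).ne'] using this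
    · intro k hk
      have hk' := Finset.mem_Icc.1 hk
      exact mul_nonneg (hm k hk'.1 hk'.2).le (mul_self_nonneg _)

theorem IsJacobiOf.diag_one_eq {N : ℕ} [NeZero N] {t m q ρ : ℕ → ℝ}
    (h : IsJacobiOf N t m q ρ) : q 1 = ∑ k ∈ Finset.Icc 1 N, m k * t k := by
  have := moment_eq_of_herglotz _ t m h.spectral 1
  simp only [pow_one] at this
  rw [this]
  simp [jacobiMatrix]

/-! ### Recurrence, expansions and the Christoffel–Darboux formula -/

section OrthoPoly

variable {q r : ℕ → ℝ}

theorem orthoPoly_succ_succ_eval (hr : ∀ j, r j ≠ 0) (n : ℕ) (x : ℝ) :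
    r (n + 1) * (orthoPoly q r (n + 2)).eval x =
      (x - q (n + 1)) * (orthoPoly q r (n + 1)).eval x - r n * (orthoPoly q r n).eval x := by
  rw [orthoPoly]
  have := hr (n + 1)
  simp only [eval_mul, eval_sub, eval_C, eval_X]
  field_simp

theorem coeff_orthoPoly_succ_succ (n i : ℕ) :
    (orthoPoly q r (n + 2)).coeff (i + 1) =
      (r (n + 1))⁻¹ * ((orthoPoly q r (n + 1)).coeff i -
        q (n + 1) * (orthoPoly q r (n + 1)).coeff (i + 1) -
        r n * (orthoPoly q r n).coeff (i + 1)) := by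
  rw [orthoPoly]
  simp [sub_mul, coeff_X_mul]

theorem coeff_orthoPoly_eq_zero (n : ℕ) : ∀ i, n ≤ i → (orthoPoly q r n).coeff i = 0 := by
  induction n using Nat.twoStepInduction with
  | zero => intro i _; simp [orthoPoly]
  | one => intro i hi; rw [orthoPoly, coeff_one]; simp; omega
  | more n h1 h2 =>
    intro i hi
    obtain ⟨i, rfl⟩ := Nat.exists_eq_add_of_le' (show 1 ≤ i by omega)
    rw [coeff_orthoPoly_succ_succ, h1 _ (by omega), h2 _ (by omega), h2 _ (by omega)]
    simp

theorem coeff_orthoPoly_ne_zero (hr : ∀ j, r j ≠ 0) (n : ℕ) :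
    (orthoPoly q r (n + 1)).coeff n ≠ 0 := by
  induction n with
  | zero => simp [orthoPoly]
  | succ n ih =>
    rw [coeff_orthoPoly_succ_succ, coeff_orthoPoly_eq_zero (n + 1) _ le_rfl,
      coeff_orthoPoly_eq_zero n _ (by omega)]
    simp [hr, ih]

theorem exists_orthoPoly_expansion (hr : ∀ j, r j ≠ 0) (n : ℕ) :
    ∀ p : ℝ[X], (∀ i, n ≤ i → p.coeff i = 0) →
      ∃ c : ℕ → ℝ, ∀ x, p.eval x = ∑ j ∈ Finset.range n, c j * (orthoPoly q r (j + 1)).eval x := by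
  induction n with
  | zero =>
    intro p hp
    have : p = 0 := by ext i; simpa using hp i (Nat.zero_le _)
    exact ⟨0, by simp [this]⟩
  | succ n ih =>
    intro p hp
    set a := p.coeff n / (orthoPoly q r (n + 1)).coeff n
    obtain ⟨c, hc⟩ := ih (p - C a * orthoPoly q r (n + 1)) (by
      intro i hi
      rcases hi.eq_or_lt with rfl | hi
      · simp [a, div_mul_cancel₀ _ (coeff_orthoPoly_ne_zero (q := q) hr n)]
      · simp [hp i hi, coeff_orthoPoly_eq_zero (q := q) (r := r) (n + 1) i hi])
    refine ⟨fun j => if j = n then a else c j, fun x => ?_⟩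
    have h1 := hc x
    rw [Finset.sum_range_succ, Finset.sum_congr rfl (g := fun j => c j *
      (orthoPoly q r (j + 1)).eval x) (fun j hj => by simp [(Finset.mem_range.1 hj).ne]), ← h1]
    simp

/-- The reproducing kernel at `0` of the polynomials of degree less than `n`. -/
noncomputable def kernelPoly (q r : ℕ → ℝ) (n : ℕ) : ℝ[X] :=
  ∑ j ∈ Finset.range n, C ((orthoPoly q r (j + 1)).eval 0) * orthoPoly q r (j + 1)

theorem eval_kernelPoly (n : ℕ) (x : ℝ) : (kernelPoly q r n).eval x =
    ∑ j ∈ Finset.range n, (orthoPoly q r (j + 1)).eval 0 * (orthoPoly q r (j + 1)).eval x := by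
  simp [kernelPoly, eval_finsetSum]

theorem coeff_kernelPoly_eq_zero (n i : ℕ) (hi : n ≤ i) : (kernelPoly q r n).coeff i = 0 := by
  rw [kernelPoly, finsetSum_coeff]
  refine Finset.sum_eq_zero fun j hj => ?_
  have := Finset.mem_range.1 hj
  rw [coeff_C_mul, coeff_orthoPoly_eq_zero _ _ (by omega), mul_zero]

/-- The Christoffel–Darboux formula with one argument at `0`: the right side telescopes by the
recurrence. -/
theorem mul_eval_kernelPoly (hr : ∀ j, r j ≠ 0) (n : ℕ) (x : ℝ) :
    x * (kernelPoly q r n).eval x =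
      r n * ((orthoPoly q r (n + 1)).eval x * (orthoPoly q r n).eval 0 -
        (orthoPoly q r n).eval x * (orthoPoly q r (n + 1)).eval 0) := by
  induction n with
  | zero => simp [eval_kernelPoly, orthoPoly]
  | succ n ih =>
    rw [eval_kernelPoly] at ih ⊢
    rw [Finset.sum_range_succ, mul_add, ih]
    have h1 := orthoPoly_succ_succ_eval (q := q) hr n x
    have h2 := orthoPoly_succ_succ_eval (q := q) hr n 0
    linear_combination (orthoPoly q r (n + 1)).eval x * h2 - (orthoPoly q r (n + 1)).eval 0 * h1

end OrthoPoly

/-! ### Reproducing property of the kernel and signs at zero -/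

namespace IsOrthoSystem

variable {N : ℕ} {t m q r : ℕ → ℝ}

theorem offdiag_ne_zero (h : IsOrthoSystem N t m q r) (j : ℕ) : r j ≠ 0 := (h.offdiag_pos j).ne'

theorem sum_mul_eq (h : IsOrthoSystem N t m q r) {n : ℕ} (hn : n ≤ N) {f g : ℝ → ℝ} {a b : ℕ → ℝ}
    (hf : ∀ x, f x = ∑ j ∈ Finset.range n, a j * (orthoPoly q r (j + 1)).eval x)
    (hg : ∀ x, g x = ∑ j ∈ Finset.range n, b j * (orthoPoly q r (j + 1)).eval x) :
    ∑ k ∈ Finset.Icc 1 N, m k * (f (t k) * g (t k)) = ∑ j ∈ Finset.range n, a j * b j := by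
  have : ∀ k, m k * (f (t k) * g (t k)) = ∑ i ∈ Finset.range n, ∑ j ∈ Finset.range n,
      a i * b j * (m k * ((orthoPoly q r (i + 1)).eval (t k) *
        (orthoPoly q r (j + 1)).eval (t k))) := by
    intro k
    rw [hf, hg, Finset.sum_mul_sum, Finset.mul_sum]
    refine Finset.sum_congr rfl fun i _ => ?_
    rw [Finset.mul_sum]
    exact Finset.sum_congr rfl fun j _ => by ring
  simp_rw [this]
  rw [Finset.sum_comm]
  refine Finset.sum_congr rfl fun i hi => ?_
  rw [Finset.sum_comm]
  have hi' := Finset.mem_range.1 hi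
  simp_rw [← Finset.mul_sum]
  rw [Finset.sum_eq_single i]
  · rw [h.orthonormal _ _ (by omega) (by omega) (by omega) (by omega)]; simp
  · intro j hj hne
    have hj' := Finset.mem_range.1 hj
    rw [h.orthonormal _ _ (by omega) (by omega) (by omega) (by omega)]
    simp; omega
  · intro h; exact absurd hi h

theorem sum_kernelPoly_mul (h : IsOrthoSystem N t m q r) {n : ℕ} (hn : n ≤ N) (p : ℝ[X])
    (hp : ∀ i, n ≤ i → p.coeff i = 0) :
    ∑ k ∈ Finset.Icc 1 N, m k * ((kernelPoly q r n).eval (t k) * p.eval (t k)) = p.eval 0 := by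
  obtain ⟨c, hc⟩ := exists_orthoPoly_expansion (q := q) h.offdiag_ne_zero n p hp
  rw [h.sum_mul_eq hn (eval_kernelPoly n) hc, hc 0]
  exact Finset.sum_congr rfl fun j _ => mul_comm _ _

theorem sum_orthoPoly_mul (h : IsOrthoSystem N t m q r) {n : ℕ} (hn : n ≤ N) (p : ℝ[X])
    (hp : ∀ i, n ≤ i → p.coeff i = 0) :
    ∑ k ∈ Finset.Icc 1 N, m k * ((orthoPoly q r (n + 1)).eval (t k) * p.eval (t k)) = 0 := by
  -- For `n = N` there is no orthonormality for `P_{N+1}`; it vanishes on the nodes instead.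
  rcases hn.eq_or_lt with rfl | hn
  · exact Finset.sum_eq_zero fun k hk => by rw [h.vanish k hk]; ring
  obtain ⟨c, hc⟩ := exists_orthoPoly_expansion (q := q) h.offdiag_ne_zero n p hp
  rw [h.sum_mul_eq (n := n + 1) (f := fun x => (orthoPoly q r (n + 1)).eval x)
    (g := fun x => p.eval x) (a := fun j => if j = n then 1 else 0)
    (b := fun j => if j < n then c j else 0) hn]
  · refine Finset.sum_eq_zero fun j _ => ?_
    by_cases hj : j = n <;> simp [hj]
  · intro x; simp
  · intro x
    rw [Finset.sum_range_succ, hc x]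
    simp only [lt_irrefl, if_false, zero_mul, add_zero]
    exact Finset.sum_congr rfl fun j hj => by rw [if_pos (Finset.mem_range.1 hj)]

theorem sum_kernelPoly_sq (h : IsOrthoSystem N t m q r) {n : ℕ} (hn : n ≤ N) :
    ∑ k ∈ Finset.Icc 1 N, m k * ((kernelPoly q r n).eval (t k) * (kernelPoly q r n).eval (t k)) =
      (kernelPoly q r n).eval 0 :=
  h.sum_kernelPoly_mul hn _ (coeff_kernelPoly_eq_zero n)

theorem kernelPoly_eval_zero_pos (n : ℕ) : 0 < (kernelPoly q r (n + 1)).eval 0 := by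
  rw [eval_kernelPoly, Finset.sum_range_succ']
  have : 0 ≤ ∑ j ∈ Finset.range n,
      (orthoPoly q r (j + 1 + 1)).eval 0 * (orthoPoly q r (j + 1 + 1)).eval 0 :=
    Finset.sum_nonneg fun j _ => mul_self_nonneg _
  have h1 : (orthoPoly q r (0 + 1)).eval 0 = 1 := by simp [orthoPoly]
  rw [h1]
  linarith

/-- Consecutive polynomials of the first kind have opposite signs at `0`. -/
theorem neg_offdiag_mul_pos (h : IsOrthoSystem N t m q r)
    (ht : ∀ k, 1 ≤ k → k ≤ N → 0 < t k) (hm : ∀ k, 1 ≤ k → k ≤ N → 0 < m k)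
    {n : ℕ} (h1 : 1 ≤ n) (hn : n ≤ N) :
    0 < -(r n * ((orthoPoly q r n).eval 0 * (orthoPoly q r (n + 1)).eval 0)) := by
  obtain ⟨n, rfl⟩ := Nat.exists_eq_add_of_le' h1
  have hK := h.sum_kernelPoly_sq hn
  have e1 := h.sum_orthoPoly_mul hn (kernelPoly q r (n + 1)) (coeff_kernelPoly_eq_zero (n + 1))
  have e2 := h.sum_kernelPoly_mul hn (orthoPoly q r (n + 1)) (coeff_orthoPoly_eq_zero (n + 1))
  -- Christoffel–Darboux is summed against the kernel: the higher polynomial is orthogonal to it,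
  -- and the lower one is reproduced at `0`.
  have key : ∑ k ∈ Finset.Icc 1 N, m k * (t k * ((kernelPoly q r (n + 1)).eval (t k) *
      (kernelPoly q r (n + 1)).eval (t k))) =
      -(r (n + 1) * ((orthoPoly q r (n + 1)).eval 0 * (orthoPoly q r (n + 1 + 1)).eval 0)) := by
    have : ∀ k, m k * (t k * ((kernelPoly q r (n + 1)).eval (t k) *
      (kernelPoly q r (n + 1)).eval (t k))) =
      r (n + 1) * (orthoPoly q r (n + 1)).eval 0 * (m k * ((orthoPoly q r (n + 1 + 1)).eval (t k) *
        (kernelPoly q r (n + 1)).eval (t k))) -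
      r (n + 1) * (orthoPoly q r (n + 1 + 1)).eval 0 * (m k * ((kernelPoly q r (n + 1)).eval (t k) *
        (orthoPoly q r (n + 1)).eval (t k))) := by
      intro k
      have := mul_eval_kernelPoly (q := q) h.offdiag_ne_zero (n + 1) (t k)
      linear_combination m k * (kernelPoly q r (n + 1)).eval (t k) * this
    simp_rw [this]
    rw [Finset.sum_sub_distrib, ← Finset.mul_sum, ← Finset.mul_sum, e1, e2]
    ring
  rw [← key]
  have hnn : ∀ k ∈ Finset.Icc 1 N, 0 ≤ m k * (t k * ((kernelPoly q r (n + 1)).eval (t k) *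
      (kernelPoly q r (n + 1)).eval (t k))) := by
    intro k hk
    have hk := Finset.mem_Icc.1 hk
    exact mul_nonneg (hm k hk.1 hk.2).le (mul_nonneg (ht k hk.1 hk.2).le (mul_self_nonneg _))
  refine lt_of_le_of_ne (Finset.sum_nonneg hnn) fun h0 => ?_
  have hz := (Finset.sum_eq_zero_iff_of_nonneg hnn).1 h0.symm
  have : (kernelPoly q r (n + 1)).eval 0 = 0 := by
    rw [← hK]
    refine Finset.sum_eq_zero fun k hk => ?_
    have h2 := hz k hk
    have hk := Finset.mem_Icc.1 hk
    have h3 := (ht k hk.1 hk.2).ne'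
    have h4 := (hm k hk.1 hk.2).ne'
    simp only [mul_eq_zero, h3, h4, false_or, or_self] at h2 ⊢
    exact h2
  exact (kernelPoly_eval_zero_pos (q := q) (r := r) n).ne' this

theorem orthoPoly_eval_zero_ne_zero (h : IsOrthoSystem N t m q r)
    (ht : ∀ k, 1 ≤ k → k ≤ N → 0 < t k) (hm : ∀ k, 1 ≤ k → k ≤ N → 0 < m k)
    {n : ℕ} (hn : n ≤ N) : (orthoPoly q r (n + 1)).eval 0 ≠ 0 := by
  rcases Nat.eq_zero_or_pos n with rfl | h1
  · simp [orthoPoly]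
  · intro h0
    have := h.neg_offdiag_mul_pos ht hm h1 hn
    rw [h0] at this
    simp at this

end IsOrthoSystem

/-! ### The Stieltjes string -/

/-- The distance from the right end of the Stieltjes string to the mass number `n + 1`. -/
noncomputable def stringRest (N : ℕ) (t m q r : ℕ → ℝ) (n : ℕ) : ℝ :=
  (∑ k ∈ Finset.Icc 1 N, m k / t k * (orthoPoly q r (n + 1)).eval (t k)) /
    (orthoPoly q r (n + 1)).eval 0

/-- The distance between the masses number `n` and `n + 1` of the Stieltjes string. -/
noncomputable def stringGap (q r : ℕ → ℝ) (n : ℕ) : ℝ :=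
  1 / -(r n * ((orthoPoly q r n).eval 0 * (orthoPoly q r (n + 1)).eval 0))

namespace IsOrthoSystem

variable {N : ℕ} {t m q r : ℕ → ℝ}

theorem stringRest_self (h : IsOrthoSystem N t m q r) : stringRest N t m q r N = 0 := by
  rw [stringRest, Finset.sum_eq_zero (fun k hk => by rw [h.vanish k hk, mul_zero]), zero_div]

/-- Christoffel–Darboux is divided by `t_k` and summed with weights `m_k`; the kernel side gives
`1`, since the kernel reproduces the constant `1`. -/
theorem stringRest_sub (h : IsOrthoSystem N t m q r)
    (ht : ∀ k, 1 ≤ k → k ≤ N → 0 < t k) (hm : ∀ k, 1 ≤ k → k ≤ N → 0 < m k)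
    {n : ℕ} (hn : n + 1 ≤ N) :
    stringRest N t m q r n - stringRest N t m q r (n + 1) = stringGap q r (n + 1) := by
  have h1 := h.orthoPoly_eval_zero_ne_zero ht hm hn
  have h2 := h.orthoPoly_eval_zero_ne_zero ht hm (show n ≤ N by omega)
  have hr := h.offdiag_ne_zero (n + 1)
  have e := h.sum_kernelPoly_mul hn 1 (fun i hi => by rw [coeff_one]; simp; omega)
  simp only [eval_one, mul_one] at e
  have key : (r (n + 1)) * ((∑ k ∈ Finset.Icc 1 N,
      m k / t k * (orthoPoly q r (n + 1 + 1)).eval (t k)) * (orthoPoly q r (n + 1)).eval 0 -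
      (∑ k ∈ Finset.Icc 1 N, m k / t k * (orthoPoly q r (n + 1)).eval (t k)) *
      (orthoPoly q r (n + 1 + 1)).eval 0) = 1 := by
    rw [← e, Finset.sum_mul, Finset.sum_mul, ← Finset.sum_sub_distrib, Finset.mul_sum]
    refine Finset.sum_congr rfl fun k hk => ?_
    have hk := Finset.mem_Icc.1 hk
    have h3 := (ht k hk.1 hk.2).ne'
    have := mul_eval_kernelPoly (q := q) h.offdiag_ne_zero (n + 1) (t k)
    field_simp
    linear_combination -(m k) * this
  rw [stringRest, stringRest, stringGap]
  generalize (∑ k ∈ Finset.Icc 1 N, m k / t k * (orthoPoly q r (n + 1)).eval (t k)) = A at key ⊢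
  generalize (∑ k ∈ Finset.Icc 1 N,
    m k / t k * (orthoPoly q r (n + 1 + 1)).eval (t k)) = B at key ⊢
  field_simp
  linear_combination -key

theorem stringGap_pos (h : IsOrthoSystem N t m q r)
    (ht : ∀ k, 1 ≤ k → k ≤ N → 0 < t k) (hm : ∀ k, 1 ≤ k → k ≤ N → 0 < m k)
    {n : ℕ} (h1 : 1 ≤ n) (hn : n ≤ N) : 0 < stringGap q r n :=
  one_div_pos.2 (h.neg_offdiag_mul_pos ht hm h1 hn)

/-- Write `p = p(0) + x · divX p`: the factor `x` cancels `1/t`, and `divX p` has degree below `n`,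
hence is orthogonal. So for the weights `m / t` the polynomial itself represents evaluation at `0`
up to a constant, as `reproducing_norm_bounds` requires. -/
theorem sum_div_mul_orthoPoly (h : IsOrthoSystem N t m q r)
    (ht : ∀ k, 1 ≤ k → k ≤ N → 0 < t k) {n : ℕ} (hn : n ≤ N) (p : ℝ[X])
    (hp : ∀ i, n + 1 ≤ i → p.coeff i = 0) :
    ∑ k ∈ Finset.Icc 1 N, m k / t k * ((orthoPoly q r (n + 1)).eval (t k) * p.eval (t k)) =
      p.eval 0 * ∑ k ∈ Finset.Icc 1 N, m k / t k * (orthoPoly q r (n + 1)).eval (t k) := by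
  have e := h.sum_orthoPoly_mul hn p.divX (fun i hi => by
    rw [coeff_divX]; exact hp _ (by omega))
  rw [← sub_eq_zero, Finset.mul_sum, ← Finset.sum_sub_distrib]
  refine Eq.trans ?_ e
  refine Finset.sum_congr rfl fun k hk => ?_
  have hk := Finset.mem_Icc.1 hk
  have h3 := (ht k hk.1 hk.2).ne'
  have : p.eval (t k) = p.eval 0 + t k * p.divX.eval (t k) := by
    conv_lhs => rw [← divX_mul_X_add p]
    simp [coeff_zero_eq_eval_zero]; ring
  rw [this]
  field_simp
  ring

end IsOrthoSystem

/-! ### Sums and products along rapidly growing sequences -/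

section Growth

variable {N : ℕ} {w : ℕ → ℝ} {c : ℝ}

theorem mul_le_of_growth (hc : 1 ≤ c) (hw : ∀ k, 1 ≤ k → k ≤ N → 0 < w k)
    (hg : ∀ k, 1 ≤ k → k < N → c * w k ≤ w (k + 1)) {i j : ℕ} (hi : 1 ≤ i) (hij : i < j)
    (hj : j ≤ N) : c * w i ≤ w j := by
  induction j, hij using Nat.le_induction with
  | base => exact hg i hi (by omega)
  | succ j hij ih =>
    have h1 := ih (by omega)
    have h2 := hg j (by omega) (by omega)
    have h3 := hw j (by omega) (by omega)
    nlinarith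

theorem sum_le_of_growth (hw : ∀ k, 1 ≤ k → k ≤ N → 0 < w k)
    (hg : ∀ k, 1 ≤ k → k < N → 100 * w k ≤ w (k + 1)) {n : ℕ} (h1 : 1 ≤ n) (hn : n ≤ N) :
    ∑ k ∈ Finset.Icc 1 n, w k ≤ 100 / 99 * w n := by
  induction n, h1 using Nat.le_induction with
  | base => simp; linarith [hw 1 le_rfl hn]
  | succ n h1 ih =>
    rw [Finset.sum_Icc_succ_top (by omega)]
    linarith [ih (by omega), hg n h1 (by omega)]

/-- The subtracted term is the tail of the geometric series and pays for the next summand in the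
induction. -/
theorem sum_inv_le_of_growth (hw : ∀ k, 1 ≤ k → k ≤ N → 0 < w k)
    (hg : ∀ k, 1 ≤ k → k < N → 100 * w k ≤ w (k + 1)) {a n : ℕ} (h1 : 1 ≤ a) (han : a ≤ n)
    (hn : n ≤ N) :
    ∑ k ∈ Finset.Icc a n, (w k)⁻¹ ≤ 100 / 99 * (w a)⁻¹ - 1 / 99 * (w n)⁻¹ := by
  induction n, han using Nat.le_induction with
  | base => simp; linarith
  | succ n han ih =>
    rw [Finset.sum_Icc_succ_top (by omega)]
    have h2 := ih (by omega)
    have h3 := hg n (by omega) (by omega)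
    have h4 := hw n (by omega) (by omega)
    have h5 := hw (n + 1) (by omega) (by omega)
    have : 100 * (w (n + 1))⁻¹ ≤ (w n)⁻¹ := by
      rw [← div_eq_mul_inv, div_le_iff₀ h5, inv_mul_eq_div, le_div_iff₀ h4]; exact h3
    linarith

/-- The factor `1 - w i / w n` strengthens the induction: as `w i / w n` drops at least a
thousandfold, it makes room for the new factor. -/
theorem prod_one_sub_ge_of_growth (hw : ∀ k, 1 ≤ k → k ≤ N → 0 < w k)
    (hg : ∀ k, 1 ≤ k → k < N → 1000 * w k ≤ w (k + 1)) {i n : ℕ} (h1 : 1 ≤ i) (hin : i ≤ n)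
    (hn : n ≤ N) :
    1 - 1 / 999 * (1 - w i / w n) ≤ ∏ j ∈ Finset.Ioc i n, (1 - w i / w j) ∧
      ∏ j ∈ Finset.Ioc i n, (1 - w i / w j) ≤ 1 := by
  induction n, hin using Nat.le_induction with
  | base => simp [(hw i h1 hn).ne']
  | succ n hin ih =>
    obtain ⟨ih1, ih2⟩ := ih (by omega)
    have h3 := hg n (by omega) (by omega)
    have h4 := hw n (by omega) (by omega)
    have h5 := hw (n + 1) (by omega) (by omega)
    have h6 := hw i h1 (by omega)
    rw [Finset.prod_Ioc_succ_top (by omega)]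
    have h7 : 0 < w i / w (n + 1) := div_pos h6 h5
    have h8 : 1000 * (w i / w (n + 1)) ≤ w i / w n := by
      rw [← mul_div_assoc, div_le_div_iff₀ h5 h4]; nlinarith
    have h9 : w i / w n ≤ 1 := by
      rw [div_le_one h4]
      rcases hin.eq_or_lt with rfl | h
      · rfl
      · linarith [mul_le_of_growth (by norm_num) hw hg h1 h (by omega)]
    set x := w i / w (n + 1)
    set y := w i / w n
    set p := ∏ j ∈ Finset.Ioc i n, (1 - w i / w j)
    constructor
    · nlinarith
    · nlinarith

end Growth

/-! ### The extremal problem for polynomials with value one at zero -/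

/-- These are values at `0` of Lagrange basis polynomials. Factors with `j < i` are at most `1` in
modulus; those with `j > i` are `(1 - t i / t j)⁻¹`. -/
theorem abs_prod_le_of_growth {N : ℕ} {t : ℕ → ℝ} (ht : ∀ k, 1 ≤ k → k ≤ N → 0 < t k)
    (hg : ∀ k, 1 ≤ k → k < N → 1000 * t k ≤ t (k + 1)) {a i : ℕ} (ha : 1 ≤ a) (hai : a ≤ i)
    (hi : i ≤ N) :
    |∏ j ∈ (Finset.Icc a N).erase i, t j / (t j - t i)| ≤ 999 / 998 := by
  have hti := ht i (by omega) hi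
  rw [Finset.abs_prod]
  have h1 : ∏ j ∈ (Finset.Icc a N).erase i, |t j / (t j - t i)| ≤
      ∏ j ∈ (Finset.Icc a N).erase i, if i < j then (1 - t i / t j)⁻¹ else 1 := by
    refine Finset.prod_le_prod (fun j _ => abs_nonneg _) fun j hj => ?_
    rw [Finset.mem_erase, Finset.mem_Icc] at hj
    have htj := ht j (by omega) (by omega)
    split_ifs with hij
    · have := mul_le_of_growth (by norm_num) ht hg (by omega) hij (by omega)
      have h2 : 0 < t j - t i := by linarith
      rw [abs_of_pos (div_pos htj h2)]
      apply le_of_eq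
      field_simp
    · have := mul_le_of_growth (by norm_num) ht hg (by omega) (show j < i by omega) (by omega)
      have h2 : 0 < t i - t j := by linarith
      rw [abs_div, abs_of_pos htj, abs_sub_comm, abs_of_pos h2, div_le_one h2]
      linarith
  refine h1.trans ?_
  rw [← Finset.prod_filter]
  have : ((Finset.Icc a N).erase i).filter (fun j => i < j) = Finset.Ioc i N := by
    ext j; simp; omega
  rw [this, Finset.prod_inv_distrib]
  have h2 := (prod_one_sub_ge_of_growth ht hg (by omega) hi le_rfl).1
  have h3 : 0 < t i / t N := div_pos hti (ht N (by omega) le_rfl)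
  rw [inv_le_comm₀ (by linarith [show t i / t N > 0 from h3]) (by norm_num)]
  norm_num
  linarith

/-- A polynomial of degree at most `d` which represents the evaluation at `0` with respect to a
rapidly increasing weight has squared norm close to the weight of the node number `N - d`. -/
theorem reproducing_norm_bounds {N d : ℕ} (hd : d < N) {t w : ℕ → ℝ}
    (ht : ∀ k, 1 ≤ k → k ≤ N → 0 < t k)
    (htg : ∀ k, 1 ≤ k → k < N → 1000 * t k ≤ t (k + 1))
    (hw : ∀ k, 1 ≤ k → k ≤ N → 0 < w k)
    (hwg : ∀ k, 1 ≤ k → k < N → 100 * w k ≤ w (k + 1))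
    {g : ℝ[X]} (hgd : ∀ i, d + 1 ≤ i → g.coeff i = 0) (hg0 : g.eval 0 = 1) {Q : ℝ}
    (hrep : ∀ p : ℝ[X], (∀ i, d + 1 ≤ i → p.coeff i = 0) →
      ∑ k ∈ Finset.Icc 1 N, w k * (g.eval (t k) * p.eval (t k)) = Q * p.eval 0) :
    98 / 100 * w (N - d) ≤ Q ∧ Q ≤ 102 / 100 * w (N - d) := by
  have hQ : ∑ k ∈ Finset.Icc 1 N, w k * (g.eval (t k) * g.eval (t k)) = Q := by
    rw [hrep g hgd, hg0, mul_one]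
  have hwN := hw (N - d) (by omega) (by omega)
  have hmono : ∀ i j, 1 ≤ i → i < j → j ≤ N → t i < t j := by
    intro i j hi hij hj
    have := mul_le_of_growth (by norm_num) ht htg hi hij hj
    linarith [ht i hi (by omega)]
  constructor
  -- Lower bound: interpolation at the top `d + 1` nodes gives `1 = g(0) = ∑ g(t_i) L_i`, and
  -- Cauchy–Schwarz gives `1 ≤ Q ∑ L_i² / w_i`, a sum dominated by `i = N - d`.
  · have hinj : Set.InjOn t (Finset.Icc (N - d) N) := by
      intro i hi j hj hij
      simp only [Finset.coe_Icc, Set.mem_Icc] at hi hj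
      by_contra hne
      rcases lt_or_gt_of_ne hne with h | h
      · exact (hmono i j (by omega) h hj.2).ne hij
      · exact (hmono j i (by omega) h hi.2).ne' hij
    have hdeg : g.degree < (Finset.Icc (N - d) N).card := by
      rw [Nat.card_Icc, degree_lt_iff_coeff_zero]
      intro i hi
      exact hgd i (by omega)
    have hlag := Lagrange.eq_interpolate hinj hdeg
    set L : ℕ → ℝ := fun i => ∏ j ∈ (Finset.Icc (N - d) N).erase i, t j / (t j - t i) with hL
    have h1 : (1 : ℝ) = ∑ i ∈ Finset.Icc (N - d) N, g.eval (t i) * L i := by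
      rw [← hg0]
      conv_lhs => rw [hlag]
      rw [Lagrange.interpolate_apply, eval_finsetSum]
      refine Finset.sum_congr rfl fun i hi => ?_
      rw [eval_mul, eval_C, Lagrange.basis, eval_prod]
      congr 1
      refine Finset.prod_congr rfl fun j hj => ?_
      simp only [Lagrange.basisDivisor, eval_mul, eval_C, eval_sub, eval_X]
      rw [← neg_sub (t j) (t i), inv_neg]
      ring
    have hCS := Finset.sum_mul_sq_le_sq_mul_sq (Finset.Icc (N - d) N)
      (fun i => √(w i) * g.eval (t i)) (fun i => L i / √(w i))
    have h2 : ∑ i ∈ Finset.Icc (N - d) N, √(w i) * g.eval (t i) * (L i / √(w i)) = 1 := by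
      rw [h1]
      refine Finset.sum_congr rfl fun i hi => ?_
      rw [Finset.mem_Icc] at hi
      have := (Real.sqrt_pos.2 (hw i (by omega) hi.2)).ne'
      field_simp
    have h3 : ∑ i ∈ Finset.Icc (N - d) N, (√(w i) * g.eval (t i)) ^ 2 ≤ Q := by
      rw [← hQ]
      calc _ = ∑ i ∈ Finset.Icc (N - d) N, w i * (g.eval (t i) * g.eval (t i)) := by
            refine Finset.sum_congr rfl fun i hi => ?_
            rw [Finset.mem_Icc] at hi
            rw [mul_pow, Real.sq_sqrt (hw i (by omega) hi.2).le, sq]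
        _ ≤ _ := by
            refine Finset.sum_le_sum_of_subset_of_nonneg ?_ ?_
            · intro i; simp only [Finset.mem_Icc]; omega
            · intro i hi _
              rw [Finset.mem_Icc] at hi
              exact mul_nonneg (hw i hi.1 hi.2).le (mul_self_nonneg _)
    have h4 : ∑ i ∈ Finset.Icc (N - d) N, (L i / √(w i)) ^ 2 ≤
        (999 / 998) ^ 2 * (100 / 99 * (w (N - d))⁻¹) := by
      calc _ ≤ ∑ i ∈ Finset.Icc (N - d) N, (999 / 998) ^ 2 * (w i)⁻¹ := by
            refine Finset.sum_le_sum fun i hi => ?_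
            rw [Finset.mem_Icc] at hi
            have hwi := hw i (by omega) hi.2
            rw [div_pow, Real.sq_sqrt hwi.le, div_eq_mul_inv]
            refine mul_le_mul_of_nonneg_right ?_ (inv_pos.2 hwi).le
            have := abs_prod_le_of_growth ht htg (show 1 ≤ N - d by omega) hi.1 hi.2
            exact sq_le_sq' (abs_le.1 this).1 (abs_le.1 this).2
        _ ≤ _ := by
            rw [← Finset.mul_sum]
            have := sum_inv_le_of_growth hw hwg (show 1 ≤ N - d by omega) (show N - d ≤ N by omega)
              le_rfl
            have h5 := inv_pos.2 (hw N (by omega) le_rfl)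
            refine mul_le_mul_of_nonneg_left ?_ (by norm_num)
            linarith
    rw [h2] at hCS
    have hQ0 : 0 ≤ Q := le_trans (Finset.sum_nonneg fun i _ => sq_nonneg _) h3
    have h6 : (1 : ℝ) ≤ Q * ((999 / 998) ^ 2 * (100 / 99 * (w (N - d))⁻¹)) := by
      calc (1 : ℝ) = 1 ^ 2 := by norm_num
        _ ≤ _ := hCS
        _ ≤ _ := mul_le_mul h3 h4 (Finset.sum_nonneg fun i _ => sq_nonneg _) hQ0
    have h7 : w (N - d) ≤ Q * ((999 / 998) ^ 2 * (100 / 99)) := by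
      have := mul_le_mul_of_nonneg_right h6 hwN.le
      rw [one_mul] at this
      refine this.trans (le_of_eq ?_)
      field_simp
    norm_num at h7
    linarith
  -- Upper bound: the test polynomial `p` has `p(0) = 1`, vanishes at the top `d` nodes and lies in
  -- `[0, 1]` at the others; expanding `0 ≤ ∑ w (g - p)²` gives `Q ≤ ∑ w p²`.
  · set p : ℝ[X] := ∏ i ∈ Finset.Ioc (N - d) N, (1 - C (t i)⁻¹ * X) with hp
    have hev : ∀ x, p.eval x = ∏ i ∈ Finset.Ioc (N - d) N, (1 - (t i)⁻¹ * x) := by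
      intro x; simp [hp, eval_prod]
    have hp0 : p.eval 0 = 1 := by rw [hev]; simp
    have hpd : ∀ i, d + 1 ≤ i → p.coeff i = 0 := by
      intro i hi
      apply coeff_eq_zero_of_natDegree_lt
      refine lt_of_le_of_lt (natDegree_prod_le _ _) ?_
      refine lt_of_le_of_lt (Finset.sum_le_card_nsmul _ _ 1 fun j _ => ?_) ?_
      · compute_degree
      · simp; omega
    have h1 : 0 ≤ ∑ k ∈ Finset.Icc 1 N, w k * (g.eval (t k) - p.eval (t k)) ^ 2 := by
      refine Finset.sum_nonneg fun k hk => ?_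
      rw [Finset.mem_Icc] at hk
      exact mul_nonneg (hw k hk.1 hk.2).le (sq_nonneg _)
    have h2 : ∑ k ∈ Finset.Icc 1 N, w k * (g.eval (t k) - p.eval (t k)) ^ 2 =
        Q - 2 * Q + ∑ k ∈ Finset.Icc 1 N, w k * p.eval (t k) ^ 2 := by
      have h3 := hrep p hpd
      rw [hp0, mul_one] at h3
      nth_rewrite 1 [← hQ]
      rw [← h3, Finset.mul_sum, ← Finset.sum_sub_distrib, ← Finset.sum_add_distrib]
      exact Finset.sum_congr rfl fun k _ => by ring
    have h3 : ∑ k ∈ Finset.Icc 1 N, w k * p.eval (t k) ^ 2 ≤ ∑ k ∈ Finset.Icc 1 (N - d), w k := by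
      rw [← Finset.sum_subset (s₁ := Finset.Icc 1 (N - d))]
      · refine Finset.sum_le_sum fun k hk => ?_
        rw [Finset.mem_Icc] at hk
        have hwk := hw k hk.1 (by omega)
        have hf : ∀ i ∈ Finset.Ioc (N - d) N, 0 ≤ 1 - (t i)⁻¹ * t k ∧ 1 - (t i)⁻¹ * t k ≤ 1 := by
          intro i hi
          rw [Finset.mem_Ioc] at hi
          have h4 := hmono k i hk.1 (by omega) hi.2
          have h5 := ht k hk.1 (by omega)
          have h6 : (t i)⁻¹ * t k ≤ 1 := by
            rw [inv_mul_eq_div, div_le_one (by linarith)]; exact h4.le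
          have h7 : 0 < (t i)⁻¹ * t k := mul_pos (inv_pos.2 (by linarith)) h5
          constructor <;> linarith
        have hp1 : p.eval (t k) ≤ 1 := by
          rw [hev]; exact Finset.prod_le_one (fun i hi => (hf i hi).1) (fun i hi => (hf i hi).2)
        have hp2 : 0 ≤ p.eval (t k) := by
          rw [hev]; exact Finset.prod_nonneg (fun i hi => (hf i hi).1)
        have : p.eval (t k) ^ 2 ≤ 1 := pow_le_one₀ hp2 hp1
        nlinarith
      · intro k; simp only [Finset.mem_Icc]; omega
      · intro k hk hk'
        rw [Finset.mem_Icc] at hk hk'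
        have : p.eval (t k) = 0 := by
          rw [hev]
          refine Finset.prod_eq_zero (i := k) (Finset.mem_Ioc.2 ⟨by omega, hk.2⟩) ?_
          rw [inv_mul_cancel₀ (ht k hk.1 hk.2).ne', sub_self]
        rw [this]; ring
    have h4 := sum_le_of_growth hw hwg (show 1 ≤ N - d by omega) (by omega)
    linarith

/-! ### Gaps and masses of the string of a completely lacunary measure -/

namespace CompletelyLacunary

variable {N : ℕ} {lam ϰ θ : ℝ} {t m : ℕ → ℝ}

theorem thousand_mul_node_le (h : CompletelyLacunary N lam ϰ θ t m) (hlam : 1000 < lam) (k : ℕ)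
    (h1 : 1 ≤ k) (hk : k < N) : 1000 * t k ≤ t (k + 1) := by
  have := h.node_growth k h1 hk
  have := h.node_pos k h1 hk.le
  nlinarith

theorem ratio_pos (h : CompletelyLacunary N lam ϰ θ t m) (k : ℕ)
    (h1 : 1 ≤ k) (hk : k ≤ N) : 0 < m k / t k :=
  div_pos (h.mass_pos k h1 hk) (h.node_pos k h1 hk)

theorem hundred_mul_ratio_le (h : CompletelyLacunary N lam ϰ θ t m) (hϰ : 100 < ϰ) (k : ℕ)
    (h1 : 1 ≤ k) (hk : k < N) : 100 * (m k / t k) ≤ m (k + 1) / t (k + 1) := by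
  have := h.ratio_growth k h1 hk
  have := h.ratio_pos k h1 hk.le
  nlinarith

theorem hundred_mul_mass_le (h : CompletelyLacunary N lam ϰ θ t m) (hlam : 1000 < lam)
    (hϰ : 100 < ϰ) (k : ℕ) (h1 : 1 ≤ k) (hk : k < N) : 100 * m k ≤ m (k + 1) := by
  have e1 := h.hundred_mul_ratio_le hϰ k h1 hk
  have e2 := h.thousand_mul_node_le hlam k h1 hk
  have e3 := h.node_pos k h1 hk.le
  have e4 := h.node_pos (k + 1) (by omega) hk
  have e5 := h.mass_pos k h1 hk.le
  rw [← mul_div_assoc, div_le_div_iff₀ e3 e4] at e1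
  have : 100 * m k * t k ≤ 100 * m k * t (k + 1) := by
    apply mul_le_mul_of_nonneg_left _ (by linarith); linarith
  exact le_of_mul_le_mul_right (this.trans e1) e3

end CompletelyLacunary

namespace IsOrthoSystem

variable {N : ℕ} {lam ϰ θ : ℝ} {t m q r : ℕ → ℝ}

/-- The extremal problem for the weights `m / t`, solved by the orthogonal polynomial divided by its
value at `0`. -/
theorem stringRest_bounds (h : IsOrthoSystem N t m q r) (hμ : CompletelyLacunary N lam ϰ θ t m)
    (hlam : 1000 < lam) (hϰ : 100 < ϰ) {n : ℕ} (hn : n < N) :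
    98 / 100 * (m (N - n) / t (N - n)) ≤ stringRest N t m q r n ∧
      stringRest N t m q r n ≤ 102 / 100 * (m (N - n) / t (N - n)) := by
  have hu := h.orthoPoly_eval_zero_ne_zero hμ.node_pos hμ.mass_pos hn.le
  refine reproducing_norm_bounds hn (w := fun k => m k / t k) hμ.node_pos
    (hμ.thousand_mul_node_le hlam) hμ.ratio_pos (hμ.hundred_mul_ratio_le hϰ)
    (g := C ((orthoPoly q r (n + 1)).eval 0)⁻¹ * orthoPoly q r (n + 1)) ?_ ?_ ?_
  · intro i hi
    rw [coeff_C_mul, coeff_orthoPoly_eq_zero _ _ hi, mul_zero]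
  · simp [hu]
  · intro p hp
    have e := h.sum_div_mul_orthoPoly hμ.node_pos hn.le p hp
    rw [stringRest, div_mul_eq_mul_div, mul_comm _ (p.eval 0), ← e, Finset.sum_div]
    refine Finset.sum_congr rfl fun k _ => ?_
    rw [eval_mul, eval_C]
    field_simp

/-- The extremal problem for the weights `m`, solved by the normalised kernel. -/
theorem kernelPoly_bounds (h : IsOrthoSystem N t m q r) (hμ : CompletelyLacunary N lam ϰ θ t m)
    (hlam : 1000 < lam) (hϰ : 100 < ϰ) {n : ℕ} (hn : n < N) :
    98 / 100 * m (N - n) ≤ ((kernelPoly q r (n + 1)).eval 0)⁻¹ ∧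
      ((kernelPoly q r (n + 1)).eval 0)⁻¹ ≤ 102 / 100 * m (N - n) := by
  have hK := (kernelPoly_eval_zero_pos (q := q) (r := r) n).ne'
  refine reproducing_norm_bounds hn hμ.node_pos
    (hμ.thousand_mul_node_le hlam) hμ.mass_pos (hμ.hundred_mul_mass_le hlam hϰ)
    (g := C ((kernelPoly q r (n + 1)).eval 0)⁻¹ * kernelPoly q r (n + 1)) ?_ ?_ ?_
  · intro i hi
    rw [coeff_C_mul, coeff_kernelPoly_eq_zero _ _ hi, mul_zero]
  · simp [hK]
  · intro p hp
    have e := h.sum_kernelPoly_mul hn p hp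
    rw [← e, Finset.mul_sum]
    refine Finset.sum_congr rfl fun k _ => ?_
    rw [eval_mul, eval_C]
    ring

/-- The gaps of the Stieltjes string are close to the numbers `m k / t k`. -/
theorem stringGap_bounds (h : IsOrthoSystem N t m q r) (hμ : CompletelyLacunary N lam ϰ θ t m)
    (hlam : 1000 < lam) (hϰ : 100 < ϰ) {n : ℕ} (hn : n < N) :
    96 / 100 * (m (N - n) / t (N - n)) ≤ stringGap q r (n + 1) ∧
      stringGap q r (n + 1) ≤ 102 / 100 * (m (N - n) / t (N - n)) := by
  rw [← h.stringRest_sub hμ.node_pos hμ.mass_pos hn]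
  obtain ⟨h1, h2⟩ := h.stringRest_bounds hμ hlam hϰ hn
  have hω := hμ.ratio_pos (N - n) (by omega) (by omega)
  -- The next remainder belongs to the node `N - n - 1`, whose ratio `m / t` is at least a hundred
  -- times smaller; after the last gap it is `0`.
  rcases Nat.lt_or_ge (n + 1) N with hn' | hn'
  · obtain ⟨h3, h4⟩ := h.stringRest_bounds hμ hlam hϰ hn'
    have h5 := hμ.hundred_mul_ratio_le hϰ (N - (n + 1)) (by omega) (by omega)
    rw [show N - (n + 1) + 1 = N - n by omega] at h5
    have h6 := hμ.ratio_pos (N - (n + 1)) (by omega) (by omega)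
    constructor <;> linarith
  · have : n + 1 = N := by omega
    rw [this, h.stringRest_self]
    constructor <;> linarith

/-- The masses of the Stieltjes string are close to the numbers `1 / m k`. -/
theorem orthoPoly_sq_bounds (h : IsOrthoSystem N t m q r)
    (hμ : CompletelyLacunary N lam ϰ θ t m)
    (hlam : 1000 < lam) (hϰ : 100 < ϰ) {n : ℕ} (hn : n < N) :
    96 / 100 ≤ (orthoPoly q r (n + 1)).eval 0 ^ 2 * m (N - n) ∧
      (orthoPoly q r (n + 1)).eval 0 ^ 2 * m (N - n) ≤ 103 / 100 := by
  have hm := hμ.mass_pos (N - n) (by omega) (by omega)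
  have hK : ∀ n, n < N → 100 / 102 ≤ (kernelPoly q r (n + 1)).eval 0 * m (N - n) ∧
      (kernelPoly q r (n + 1)).eval 0 * m (N - n) ≤ 100 / 98 := by
    intro n hn
    obtain ⟨h1, h2⟩ := h.kernelPoly_bounds hμ hlam hϰ hn
    have h3 := kernelPoly_eval_zero_pos (q := q) (r := r) n
    have h4 := mul_le_mul_of_nonneg_right h1 h3.le
    have h5 := mul_le_mul_of_nonneg_right h2 h3.le
    rw [inv_mul_cancel₀ h3.ne'] at h4 h5
    constructor <;> linarith
  obtain ⟨h1, h2⟩ := hK n hn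
  -- The square is a difference of consecutive kernels at `0`; the earlier one has size `1 / m (N -
  -- n + 1)`, a small fraction of the later one.
  have e : (kernelPoly q r (n + 1)).eval 0 = (kernelPoly q r n).eval 0 +
      (orthoPoly q r (n + 1)).eval 0 ^ 2 := by
    rw [eval_kernelPoly, eval_kernelPoly, Finset.sum_range_succ, sq]
  rw [e] at h1 h2
  rcases Nat.eq_zero_or_pos n with rfl | hn0
  · have : (kernelPoly q r 0).eval 0 = 0 := by simp [eval_kernelPoly]
    rw [this, zero_add] at h1 h2
    constructor <;> linarith
  · obtain ⟨l, rfl⟩ := Nat.exists_eq_add_of_le' hn0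
    obtain ⟨h3, h4⟩ := hK l (by omega)
    have h5 := hμ.hundred_mul_mass_le hlam hϰ (N - (l + 1)) (by omega) (by omega)
    rw [show N - (l + 1) + 1 = N - l by omega] at h5
    have h6 := kernelPoly_eval_zero_pos (q := q) (r := r) l
    have h7 : (kernelPoly q r (l + 1)).eval 0 * (100 * m (N - (l + 1))) ≤ 100 / 98 :=
      (mul_le_mul_of_nonneg_left h5 h6.le).trans h4
    have h8 := mul_pos h6 hm
    constructor <;> nlinarith

end IsOrthoSystem

/-! ### Geometry of consecutive directions -/

theorem inner_plane (a b : Plane) : inner ℝ a b = a 0 * b 0 + a 1 * b 1 := by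
  simp [PiLp.inner_apply, Fin.sum_univ_two]; ring

theorem inner_perp (a b : Plane) : inner ℝ (perp a) b = a 0 * b 1 - a 1 * b 0 := by
  rw [inner_plane]; simp [perp]; ring

theorem chainDelta_eq (e : ℕ → Plane) (k : ℕ) :
    chainDelta e k = e k 1 * e (k + 1) 0 - e k 0 * e (k + 1) 1 := by
  rw [chainDelta, inner_perp]; ring

/-- A nonempty open set is not null, so the trace condition holds at some point of it. -/
theorem IsIndivisible.direction_sq {H : ℝ → Matrix (Fin 2) (Fin 2) ℝ} {I : Set ℝ} {e : Plane}
    (h : IsIndivisible H I e) (hH : IsHamiltonian H) : e 0 ^ 2 + e 1 ^ 2 = 1 := by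
  have h1 : ∀ᵐ x ∂(MeasureTheory.volume.restrict I), (H x).trace = 1 :=
    MeasureTheory.ae_restrict_of_ae_restrict_of_subset h.subset hH.trace_one
  rw [MeasureTheory.ae_restrict_iff' h.isOpen.measurableSet] at h1
  have h2 : ∃ x ∈ I, (H x).trace = 1 := by
    by_contra! hc
    have h3 : ∀ᵐ x ∂(MeasureTheory.volume : MeasureTheory.Measure ℝ), x ∉ I := by
      filter_upwards [h1] with x hx hxI
      exact hc x hxI (hx hxI)
    exact (h.isOpen.measure_pos MeasureTheory.volume h.nonempty).ne'
      (MeasureTheory.measure_eq_zero_iff_ae_notMem.2 h3)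
  obtain ⟨x, hx, hx1⟩ := h2
  rw [h.eq_rankOne x hx, Matrix.trace_fin_two] at hx1
  simp only [rankOne, Matrix.of_apply] at hx1
  linarith

theorem IsIndivisibleChain.direction_sq {N : ℕ} {H : ℝ → Matrix (Fin 2) (Fin 2) ℝ} {l : ℕ → ℝ}
    {e : ℕ → Plane} (h : IsIndivisibleChain N H l e) {k : ℕ} (h1 : 1 ≤ k) (hk : k ≤ N + 1) :
    e k 0 ^ 2 + e k 1 ^ 2 = 1 := by
  rcases hk.eq_or_lt with rfl | hk
  · exact h.last.direction_sq h.hamiltonian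
  · exact (h.interval k h1 (by omega)).direction_sq h.hamiltonian

theorem chainCot_mul_chainDelta {e : ℕ → Plane} {k : ℕ} (hδ : 0 < chainDelta e k) :
    chainCot e k * chainDelta e k = -(e k 0 * e (k + 1) 0 + e k 1 * e (k + 1) 1) := by
  have : inner ℝ (perp (e k)) (e (k + 1)) ≠ 0 := by
    rw [chainDelta] at hδ; intro h; rw [h] at hδ; simp at hδ
  rw [chainCot, chainDelta, ← inner_plane, mul_neg, div_mul_cancel₀ _ this]

/-- In the orthonormal basis `e_k`, `e_k^⊥` the vector `e_{k+1}` has coordinates `-chainCot · δ_k`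
and `-δ_k`. Together with `fst_eq`, the expansion of `e_k` around `e_{k+1}`, this yields a
three-term recurrence for first coordinates. -/
theorem fst_succ_eq {e : ℕ → Plane} {k : ℕ} (h : e k 0 ^ 2 + e k 1 ^ 2 = 1)
    (hδ : 0 < chainDelta e k) :
    e (k + 1) 0 = (e k 1 - chainCot e k * e k 0) * chainDelta e k := by
  have h1 := chainCot_mul_chainDelta hδ
  have h2 := chainDelta_eq e k
  linear_combination (-e (k + 1) 0) * h - e k 0 * (- h1) - e k 1 * h2

theorem fst_eq {e : ℕ → Plane} {k : ℕ} (h : e (k + 1) 0 ^ 2 + e (k + 1) 1 ^ 2 = 1)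
    (hδ : 0 < chainDelta e k) :
    e k 0 = (-e (k + 1) 1 - chainCot e k * e (k + 1) 0) * chainDelta e k := by
  have h1 := chainCot_mul_chainDelta hδ
  have h2 := chainDelta_eq e k
  linear_combination (-e k 0) * h + e (k + 1) 0 * h1 + e (k + 1) 1 * h2

/-! ### Scaled directions as solutions of the Jacobi recurrence -/

namespace IsCanonicalSystemOf

variable {N : ℕ} {t m q ρ : ℕ → ℝ} {H : ℝ → Matrix (Fin 2) (Fin 2) ℝ} {l : ℕ → ℝ} {e : ℕ → Plane}

/-- Square roots of the lengths, with a value at `N + 1` that makes `chainDelta_eq_one_div`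
hold up to `N`. -/
noncomputable def rootLength (N : ℕ) (l : ℕ → ℝ) (e : ℕ → Plane) (j : ℕ) : ℝ :=
  if j ≤ N then √(l j) else 1 / (√(l N) * chainDelta e N)

theorem rootLength_of_le {j : ℕ} (hj : j ≤ N) : rootLength N l e j = √(l j) := if_pos hj

theorem rootLength_pos (h : IsCanonicalSystemOf N q ρ H l e) (hN : 1 ≤ N) {j : ℕ} (h1 : 1 ≤ j) :
    0 < rootLength N l e j := by
  unfold rootLength
  split_ifs with hj
  · exact Real.sqrt_pos.2 (h.chain.length_pos j h1 hj)
  · exact one_div_pos.2 (mul_pos (Real.sqrt_pos.2 (h.chain.length_pos N hN le_rfl))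
      (h.corresponds.sign N hN le_rfl))

theorem offdiag_mul_chainDelta (h : IsCanonicalSystemOf N q ρ H l e) (hN : 1 ≤ N) {j : ℕ}
    (h1 : 1 ≤ j) (hj : j ≤ N) :
    extendByOne N ρ j * (rootLength N l e j * rootLength N l e (j + 1) * chainDelta e j) = 1 := by
  have hδ := h.corresponds.sign j h1 hj
  have hs := h.rootLength_pos hN h1
  have hs' := h.rootLength_pos hN (show 1 ≤ j + 1 by omega)
  rcases hj.eq_or_lt with rfl | hj'
  · have h2 : extendByOne j ρ j = 1 := by simp [extendByOne]
    rw [rootLength_of_le le_rfl] at *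
    rw [h2, rootLength, if_neg (by omega)]
    field_simp
  · rw [extendByOne_of_lt h1 hj', h.corresponds.offdiag j h1 hj',
      Real.sqrt_mul (h.chain.length_pos (j + 1) (by omega) hj').le]
    rw [rootLength_of_le hj, rootLength_of_le hj'] at *
    have : inner ℝ (perp (e j)) (e (j + 1)) = -chainDelta e j := by rw [chainDelta, neg_neg]
    rw [this]
    field_simp

/-- Expanding both neighbours around `e_j` and adding cancels the second coordinate of `e_j`, while
the cotangents add up to `q_j l_j`. So `√l_j e_j⁺` obeys the recurrence of the polynomials at `0`.
-/
theorem rootLength_mul_fst (h : IsCanonicalSystemOf N q ρ H l e)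
    (ho : IsOrthoSystem N t m q (extendByOne N ρ)) (hN : 1 ≤ N) {j : ℕ} (hj : j ≤ N) :
    rootLength N l e (j + 1) * e (j + 1) 0 =
      rootLength N l e 1 * (orthoPoly q (extendByOne N ρ) (j + 1)).eval 0 := by
  have hsq : ∀ j, 1 ≤ j → j ≤ N → rootLength N l e j * rootLength N l e j = l j := by
    intro j h1 hj
    rw [rootLength_of_le hj, Real.mul_self_sqrt (h.chain.length_pos j h1 hj).le]
  induction j using Nat.twoStepInduction with
  | zero => simp [h.direction_one, orthoPoly]
  | one =>
    have h1 := fst_succ_eq (h.chain.direction_sq le_rfl (by omega)) (h.corresponds.sign 1 le_rfl hj)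
    have h2 := h.offdiag_mul_chainDelta hN le_rfl hj
    have h3 := h.corresponds.diag_one
    have h4 := hsq 1 le_rfl hj
    have h5 := orthoPoly_succ_succ_eval (q := q) ho.offdiag_ne_zero 0 0
    have hs := (h.rootLength_pos hN le_rfl).ne'
    have e0 : e 1 0 = 1 := by simp [h.direction_one]
    have e1 : e 1 1 = 0 := by simp [h.direction_one]
    rw [e0, e1] at h1
    rw [e0, e1, ← h4] at h3
    have h6 : q 1 * (rootLength N l e 1 * rootLength N l e 1) = chainCot e 1 := by
      rw [h3]; field_simp; ring
    have hr := ho.offdiag_ne_zero 1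
    have hP : (orthoPoly q (extendByOne N ρ) (0 + 1)).eval 0 = 1 := by simp [orthoPoly]
    have hP0 : (orthoPoly q (extendByOne N ρ) 0).eval 0 = 0 := by simp [orthoPoly]
    rw [hP, hP0] at h5
    rw [h1]
    refine mul_left_cancel₀ hr (mul_left_cancel₀ hs ?_)
    simp only [zero_add, Nat.reduceAdd] at h5 h2 ⊢
    linear_combination (-chainCot e 1) * h2 - rootLength N l e 1 ^ 2 * h5 + h6
  | more j ih1 ih2 =>
    have i1 := ih1 (by omega)
    have i2 := ih2 (by omega)
    have g1 := fst_succ_eq (h.chain.direction_sq (k := j + 2) (by omega) (by omega))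
      (h.corresponds.sign (j + 2) (by omega) hj)
    have g2 := fst_eq (h.chain.direction_sq (k := j + 2) (by omega) (by omega))
      (h.corresponds.sign (j + 1) (by omega) (by omega))
    have h2 := h.offdiag_mul_chainDelta hN (j := j + 2) (by omega) hj
    have h2' := h.offdiag_mul_chainDelta hN (j := j + 1) (by omega) (by omega)
    have h3 := h.corresponds.diag (j + 2) (by omega) hj
    have h4 := hsq (j + 2) (by omega) hj
    have h5 := orthoPoly_succ_succ_eval (q := q) ho.offdiag_ne_zero (j + 1) 0
    have hs := (h.rootLength_pos hN (j := j + 2) (by omega)).ne'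
    have hr := ho.offdiag_ne_zero (j + 2)
    simp only [add_assoc, Nat.reduceAdd, Nat.add_one_sub_one] at *
    rw [← h4] at h3
    have h6 : q (j + 2) * (rootLength N l e (j + 2) * rootLength N l e (j + 2)) =
        chainCot e (j + 2) + chainCot e (j + 1) := by
      rw [h3]; field_simp
    refine mul_left_cancel₀ hr (mul_left_cancel₀ hs ?_)
    generalize orthoPoly q (extendByOne N ρ) = P at *
    generalize extendByOne N ρ = r at *
    generalize rootLength N l e = s at *
    have k1 : s (j + 2) * (r (j + 2) * (s (j + 3) * e (j + 3) 0)) =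
        e (j + 2) 1 - chainCot e (j + 2) * e (j + 2) 0 := by
      rw [g1]; linear_combination (e (j + 2) 1 - chainCot e (j + 2) * e (j + 2) 0) * h2
    have k2 : s (j + 2) * (r (j + 1) * (s (j + 1) * e (j + 1) 0)) =
        -e (j + 2) 1 - chainCot e (j + 1) * e (j + 2) 0 := by
      rw [g2]; linear_combination (-e (j + 2) 1 - chainCot e (j + 1) * e (j + 2) 0) * h2'
    have k3 : s (j + 2) * (r (j + 2) * (s 1 * (P (j + 3)).eval 0)) =
        s (j + 2) * s 1 * (-q (j + 2) * (P (j + 2)).eval 0 - r (j + 1) * (P (j + 1)).eval 0) := by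
      linear_combination s (j + 2) * s 1 * h5
    rw [k1, k3]
    linear_combination k2 + e (j + 2) 0 * h6 - s (j + 2) * r (j + 1) * i1
      - s (j + 2) * q (j + 2) * i2

/-- The formula for `δ_j` says that the Wronskian of the two coordinates is constant. Given the
first coordinates, the slope `e⁻ / e⁺` therefore grows by `stringGap / l_1` at each step, and the
gaps telescope. -/
theorem rootLength_mul_snd (h : IsCanonicalSystemOf N q ρ H l e)
    (ho : IsOrthoSystem N t m q (extendByOne N ρ)) (ht : ∀ k, 1 ≤ k → k ≤ N → 0 < t k)
    (hm : ∀ k, 1 ≤ k → k ≤ N → 0 < m k) (hN : 1 ≤ N) {j : ℕ} (hj : j ≤ N) :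
    rootLength N l e 1 * (rootLength N l e (j + 1) * e (j + 1) 1) =
      (orthoPoly q (extendByOne N ρ) (j + 1)).eval 0 *
        (stringRest N t m q (extendByOne N ρ) 0 - stringRest N t m q (extendByOne N ρ) j) := by
  induction j with
  | zero => simp [h.direction_one]
  | succ j ih =>
    have i1 := ih (by omega)
    have g1 := h.rootLength_mul_fst ho hN (j := j) (by omega)
    have g2 := h.rootLength_mul_fst ho hN hj
    have g3 := ho.stringRest_sub ht hm hj
    have u1 := ho.orthoPoly_eval_zero_ne_zero ht hm (n := j) (by omega)
    have u2 := ho.orthoPoly_eval_zero_ne_zero ht hm (n := j + 1) hj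
    have hr := ho.offdiag_ne_zero (j + 1)
    have h2 := h.offdiag_mul_chainDelta hN (j := j + 1) (by omega) hj
    rw [chainDelta_eq] at h2
    have g4 : extendByOne N ρ (j + 1) * ((orthoPoly q (extendByOne N ρ) (j + 1)).eval 0 *
      (orthoPoly q (extendByOne N ρ) (j + 1 + 1)).eval 0) * stringGap q (extendByOne N ρ) (j + 1)
        = -1 := by
      rw [stringGap]; field_simp
    rw [← g3] at g4
    refine mul_left_cancel₀ hr (mul_left_cancel₀ u1 ?_)
    generalize orthoPoly q (extendByOne N ρ) = P at *
    generalize stringRest N t m q (extendByOne N ρ) = R at *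
    generalize extendByOne N ρ = r at *
    generalize rootLength N l e = s at *
    linear_combination (-1) * h2 - g4 - r (j + 1) * s (j + 1 + 1) * e (j + 1 + 1) 1 * g1 +
      r (j + 1) * s (j + 1) * e (j + 1) 1 * g2 + r (j + 1) * (P (j + 1 + 1)).eval 0 * i1

end IsCanonicalSystemOf

/-! ### Estimates of lengths and angles -/

namespace IsCanonicalSystemOf

variable {N : ℕ} {lam ϰ θ : ℝ} {t m q ρ : ℕ → ℝ} {H : ℝ → Matrix (Fin 2) (Fin 2) ℝ} {l : ℕ → ℝ}
  {e : ℕ → Plane}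

/-- The cotangent at `e_1` is `q_1 l_1 = 1000`, so the unit vector `e_2` is `-δ_1 (1000, 1)`. -/
theorem sq_chainDelta_one (h : IsCanonicalSystemOf N q ρ H l e) (hN : 1 ≤ N) (hq : q 1 ≠ 0) :
    1000001 * chainDelta e 1 ^ 2 = 1 := by
  have hδ := h.corresponds.sign 1 le_rfl hN
  have h1 := chainCot_mul_chainDelta hδ
  have h2 := chainDelta_eq e 1
  have h3 := h.corresponds.diag_one
  have h4 := h.chain.direction_sq (k := 1 + 1) (by omega) (by omega)
  have e0 : e 1 0 = 1 := by simp [h.direction_one]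
  have e1 : e 1 1 = 0 := by simp [h.direction_one]
  rw [h.length_one, e0, e1] at h3
  have h5 : chainCot e 1 = 1000 := by
    field_simp at h3
    linarith
  rw [e0, e1, h5] at h1
  rw [e0, e1] at h2
  have h6 : e (1 + 1) 0 = -1000 * chainDelta e 1 := by linarith
  have h7 : e (1 + 1) 1 = -chainDelta e 1 := by linarith
  rw [h6, h7] at h4
  linarith

/-- As `e` is a unit vector, `s² = l_1 u² (1 + (D / l_1)²)`, where `u` is the polynomial at `0` and
`D` a distance along the string. Since `q_1 |D| ≤ 1.02` and `q_1 l_1 = 1000`, the correction is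
tiny; this is where the normalisation of `l_1` enters. -/
theorem sq_rootLength_bounds (h : IsCanonicalSystemOf N q ρ H l e)
    (ho : IsOrthoSystem N t m q (extendByOne N ρ)) (hμ : CompletelyLacunary N lam ϰ θ t m)
    (hlam : 1000 < lam) (hϰ : 100 < ϰ) (hN : 1 ≤ N)
    (hq : 0 < q 1) (hqm : q 1 * (m N / t N) ≤ 1) {j : ℕ} (hj : j ≤ N) :
    l 1 * (orthoPoly q (extendByOne N ρ) (j + 1)).eval 0 ^ 2 ≤ rootLength N l e (j + 1) ^ 2 ∧
      rootLength N l e (j + 1) ^ 2 ≤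
        101 / 100 * (l 1 * (orthoPoly q (extendByOne N ρ) (j + 1)).eval 0 ^ 2) := by
  have hx := h.rootLength_mul_fst ho hN hj
  have hy := h.rootLength_mul_snd ho hμ.node_pos hμ.mass_pos hN hj
  have he := h.chain.direction_sq (k := j + 1) (by omega) (by omega)
  have hl := h.chain.length_pos 1 le_rfl hN
  have hs : rootLength N l e 1 ^ 2 = l 1 := by
    rw [rootLength_of_le hN, Real.sq_sqrt hl.le]
  have hR : ∀ j, j ≤ N → 0 ≤ stringRest N t m q (extendByOne N ρ) j ∧
      stringRest N t m q (extendByOne N ρ) j ≤ 102 / 100 * (m N / t N) := by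
    intro j hj
    have hω := hμ.ratio_pos N hN le_rfl
    rcases hj.eq_or_lt with rfl | hj
    · rw [ho.stringRest_self]; constructor <;> linarith
    · obtain ⟨h1, h2⟩ := ho.stringRest_bounds hμ hlam hϰ hj
      have h3 := hμ.ratio_pos (N - j) (by omega) (by omega)
      have h4 : m (N - j) / t (N - j) ≤ m N / t N := by
        rcases Nat.eq_zero_or_pos j with rfl | hj0
        · simp
        · have := mul_le_of_growth (w := fun k => m k / t k) (by norm_num) hμ.ratio_pos
            (hμ.hundred_mul_ratio_le hϰ) (show 1 ≤ N - j by omega) (show N - j < N by omega) le_rfl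
          linarith
      constructor <;> linarith
  obtain ⟨r1, r2⟩ := hR 0 (by omega)
  obtain ⟨r3, r4⟩ := hR j hj
  set D := stringRest N t m q (extendByOne N ρ) 0 - stringRest N t m q (extendByOne N ρ) j
  set u := (orthoPoly q (extendByOne N ρ) (j + 1)).eval 0
  set s := rootLength N l e (j + 1)
  set s₁ := rootLength N l e 1
  have key : l 1 * s ^ 2 = l 1 * (l 1 * u ^ 2) + u ^ 2 * D ^ 2 := by
    have h1 : (s * e (j + 1) 0) ^ 2 = l 1 * u ^ 2 := by rw [hx, mul_pow, hs]
    have h2 : l 1 * (s * e (j + 1) 1) ^ 2 = u ^ 2 * D ^ 2 := by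
      rw [← hs, ← mul_pow, hy, mul_pow]
    linear_combination l 1 * h1 + h2 - l 1 * s ^ 2 * he
  have hD : q 1 * |D| ≤ 102 / 100 := by
    have h1 : |D| ≤ 102 / 100 * (m N / t N) := by
      rw [abs_le]; constructor <;> simp only [D] <;> linarith
    nlinarith
  have hlq : q 1 * l 1 = 1000 := by rw [h.length_one]; field_simp
  have hD2 : |D| ≤ 102 / 100000 * l 1 := by
    have : q 1 * |D| ≤ q 1 * (102 / 100000 * l 1) := by linarith
    exact le_of_mul_le_mul_left this hq
  have hD3 : D ^ 2 ≤ 1 / 100 * l 1 ^ 2 := by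
    rw [← sq_abs D]
    have := pow_le_pow_left₀ (abs_nonneg D) hD2 2
    nlinarith [sq_nonneg (l 1)]
  have hu := sq_nonneg u
  constructor
  · refine le_of_mul_le_mul_left ?_ hl
    rw [key]
    have := mul_nonneg hu (sq_nonneg D)
    linarith
  · refine le_of_mul_le_mul_left ?_ hl
    rw [key]
    have := mul_le_mul_of_nonneg_left hD3 hu
    linarith

/-- Both `r s s' δ` and `-r u u' g` equal `1`, and `s s' ≈ l_1 |u u'|`, hence `l_1 δ ≈ g`. Squares
are compared, so that the signs of `u`, `u'` do not matter. -/
theorem chainDelta_bounds (h : IsCanonicalSystemOf N q ρ H l e)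
    (ho : IsOrthoSystem N t m q (extendByOne N ρ)) (hμ : CompletelyLacunary N lam ϰ θ t m)
    (hlam : 1000 < lam) (hϰ : 100 < ϰ)
    (hq : 0 < q 1) (hqm : q 1 * (m N / t N) ≤ 1) {n : ℕ} (hn : n < N) :
    95 / 100 * (m (N - n) / t (N - n)) ≤ l 1 * chainDelta e (n + 1) ∧
      l 1 * chainDelta e (n + 1) ≤ 102 / 100 * (m (N - n) / t (N - n)) := by
  have hN : 1 ≤ N := by omega
  have hl := h.chain.length_pos 1 le_rfl hN
  have hδ := h.corresponds.sign (n + 1) (by omega) (by omega)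
  have h1 := h.offdiag_mul_chainDelta hN (j := n + 1) (by omega) (by omega)
  have hr := ho.offdiag_pos (n + 1)
  obtain ⟨a1, a2⟩ := h.sq_rootLength_bounds ho hμ hlam hϰ hN hq hqm hn.le
  obtain ⟨b1, b2⟩ := h.sq_rootLength_bounds ho hμ hlam hϰ hN hq hqm (j := n + 1) hn
  have hs := h.rootLength_pos hN (j := n + 1) (by omega)
  have hs' := h.rootLength_pos hN (j := n + 1 + 1) (by omega)
  have u1 := ho.orthoPoly_eval_zero_ne_zero hμ.node_pos hμ.mass_pos hn.le
  have u2 := ho.orthoPoly_eval_zero_ne_zero hμ.node_pos hμ.mass_pos (n := n + 1) hn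
  obtain ⟨g1, g2⟩ := ho.stringGap_bounds hμ hlam hϰ hn
  have hg := ho.stringGap_pos hμ.node_pos hμ.mass_pos (n := n + 1) (by omega) hn
  have hω := hμ.ratio_pos (N - n) (by omega) (by omega)
  have hgap : extendByOne N ρ (n + 1) * ((orthoPoly q (extendByOne N ρ) (n + 1)).eval 0 *
      (orthoPoly q (extendByOne N ρ) (n + 1 + 1)).eval 0) * stringGap q (extendByOne N ρ) (n + 1)
        = -1 := by
    have := hr.ne'
    rw [stringGap]; field_simp
  set u := (orthoPoly q (extendByOne N ρ) (n + 1)).eval 0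
  set u' := (orthoPoly q (extendByOne N ρ) (n + 1 + 1)).eval 0
  set s := rootLength N l e (n + 1)
  set s' := rootLength N l e (n + 1 + 1)
  set g := stringGap q (extendByOne N ρ) (n + 1)
  set r := extendByOne N ρ (n + 1)
  set δ := chainDelta e (n + 1)
  have hsq : (u ^ 2 * u' ^ 2) * g ^ 2 = (s ^ 2 * s' ^ 2) * δ ^ 2 := by
    have hr2 : r ^ 2 ≠ 0 := pow_ne_zero 2 hr.ne'
    refine mul_left_cancel₀ hr2 ?_
    have e1 : r ^ 2 * (u ^ 2 * u' ^ 2 * g ^ 2) = 1 := by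
      rw [show r ^ 2 * (u ^ 2 * u' ^ 2 * g ^ 2) = (r * (u * u') * g) ^ 2 by ring, hgap]; norm_num
    have e2 : r ^ 2 * (s ^ 2 * s' ^ 2 * δ ^ 2) = 1 := by
      rw [show r ^ 2 * (s ^ 2 * s' ^ 2 * δ ^ 2) = (r * (s * s' * δ)) ^ 2 by ring, h1]; norm_num
    rw [e1, e2]
  have hu : 0 < u ^ 2 := by positivity
  have hu' : 0 < u' ^ 2 := by positivity
  have lo : (l 1 * u ^ 2) * (l 1 * u' ^ 2) ≤ s ^ 2 * s' ^ 2 :=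
    mul_le_mul a1 b1 (by positivity) (by positivity)
  have hi : s ^ 2 * s' ^ 2 ≤ (101 / 100 * (l 1 * u ^ 2)) * (101 / 100 * (l 1 * u' ^ 2)) :=
    mul_le_mul a2 b2 (by positivity) (by positivity)
  have hU : 0 < u ^ 2 * u' ^ 2 := mul_pos hu hu'
  have d1 : (l 1 * δ) ^ 2 ≤ g ^ 2 := by
    refine le_of_mul_le_mul_left ?_ hU
    rw [hsq]
    have := mul_le_mul_of_nonneg_right lo (sq_nonneg δ)
    linarith
  have d2 : g ^ 2 ≤ (101 / 100 * (l 1 * δ)) ^ 2 := by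
    refine le_of_mul_le_mul_left ?_ hU
    rw [hsq]
    have := mul_le_mul_of_nonneg_right hi (sq_nonneg δ)
    linarith
  have d3 := (abs_le_of_sq_le_sq' d1 hg.le).2
  have d4 := (abs_le_of_sq_le_sq' d2 (by positivity)).2
  constructor <;> linarith

theorem length_bounds (h : IsCanonicalSystemOf N q ρ H l e)
    (ho : IsOrthoSystem N t m q (extendByOne N ρ)) (hμ : CompletelyLacunary N lam ϰ θ t m)
    (hlam : 1000 < lam) (hϰ : 100 < ϰ)
    (hq : 0 < q 1) (hqm : q 1 * (m N / t N) ≤ 1) {n : ℕ} (hn : n < N) :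
    96 / 100 * l 1 ≤ l (n + 1) * m (N - n) ∧ l (n + 1) * m (N - n) ≤ 105 / 100 * l 1 := by
  have hl := h.chain.length_pos 1 le_rfl (by omega)
  obtain ⟨a1, a2⟩ := h.sq_rootLength_bounds ho hμ hlam hϰ (by omega) hq hqm hn.le
  obtain ⟨b1, b2⟩ := ho.orthoPoly_sq_bounds hμ hlam hϰ hn
  rw [rootLength_of_le (by omega), Real.sq_sqrt (h.chain.length_pos (n + 1) (by omega) hn).le]
    at a1 a2
  have hm := hμ.mass_pos (N - n) (by omega) (by omega)
  have a3 := mul_le_mul_of_nonneg_right a1 hm.le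
  have a4 := mul_le_mul_of_nonneg_right a2 hm.le
  have b3 := mul_le_mul_of_nonneg_left b1 hl.le
  have b4 := mul_le_mul_of_nonneg_left b2 hl.le
  constructor <;> linarith

/-- The lengths and angles of a corresponding canonical system are lacunary. -/
theorem lacunary_bounds (h : IsCanonicalSystemOf N q ρ H l e)
    (ho : IsOrthoSystem N t m q (extendByOne N ρ)) (hμ : CompletelyLacunary N lam ϰ θ t m)
    (hlam : 1000 < lam) (hϰ : 100 < ϰ) (hθ : 0 < θ)
    (hq : 0 < q 1) (hqm : q 1 * (m N / t N) ≤ 1) {n : ℕ} (h1 : 1 ≤ n) (hn : n < N) :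
    chainDelta e n / chainDelta e (n + 1) > 1 / 10 * ϰ ∧
      l (n + 1) * chainDelta e (n + 1) / (l n * chainDelta e n) > 1 / 10 * lam ∧
      l (n + 1) * chainDelta e (n + 1) ^ 2 / (l n * chainDelta e n ^ 2) > 1 / 1000 * θ⁻¹ := by
  obtain ⟨n, rfl⟩ := Nat.exists_eq_add_of_le' h1
  -- The numbering is reversed: the intervals `n + 1`, `n + 2` belong to the nodes `k + 2`, `k + 1`.
  obtain ⟨k, hk⟩ : ∃ k, N = n + 1 + k + 1 := ⟨N - n - 2, by omega⟩
  have hl := h.chain.length_pos 1 le_rfl (by omega)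
  obtain ⟨d1, d2⟩ := h.chainDelta_bounds ho hμ hlam hϰ hq hqm (n := n) (by omega)
  obtain ⟨d3, d4⟩ := h.chainDelta_bounds ho hμ hlam hϰ hq hqm (n := n + 1) (by omega)
  obtain ⟨l1, l2⟩ := h.length_bounds ho hμ hlam hϰ hq hqm (n := n) (by omega)
  obtain ⟨l3, l4⟩ := h.length_bounds ho hμ hlam hϰ hq hqm (n := n + 1) (by omega)
  have g1 := hμ.node_growth (k + 1) (by omega) (by omega)
  have g2 := hμ.ratio_growth (k + 1) (by omega) (by omega)
  have g3 := hμ.ratio_decay (k + 1) (by omega) (by omega)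
  have t1 := hμ.node_pos (k + 1) (by omega) (by omega)
  have t2 := hμ.node_pos (k + 1 + 1) (by omega) (by omega)
  have m1 := hμ.mass_pos (k + 1) (by omega) (by omega)
  have m2 := hμ.mass_pos (k + 1 + 1) (by omega) (by omega)
  have e1 := h.corresponds.sign (n + 1) (by omega) (by omega)
  have e2 := h.corresponds.sign (n + 1 + 1) (by omega) (by omega)
  have p1 := h.chain.length_pos (n + 1) (by omega) (by omega)
  have p2 := h.chain.length_pos (n + 1 + 1) (by omega) (by omega)
  rw [show N - n = k + 1 + 1 by omega] at *
  rw [show N - (n + 1) = k + 1 by omega] at *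
  generalize chainDelta e (n + 1) = δ at *
  generalize chainDelta e (n + 1 + 1) = δ' at *
  generalize l (n + 1) = a at *
  generalize l (n + 1 + 1) = a' at *
  generalize l 1 = L at *
  generalize t (k + 1 + 1) = T at *
  generalize t (k + 1) = T' at *
  generalize m (k + 1 + 1) = M at *
  generalize m (k + 1) = M' at *
  have f1 : 95 / 100 * M ≤ L * δ * T := by
    rw [← mul_div_assoc, div_le_iff₀ t2] at d1; exact d1
  have f2 : L * δ * T ≤ 102 / 100 * M := by
    rw [← mul_div_assoc, le_div_iff₀ t2] at d2; exact d2
  have f3 : 95 / 100 * M' ≤ L * δ' * T' := by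
    rw [← mul_div_assoc, div_le_iff₀ t1] at d3; exact d3
  have f4 : L * δ' * T' ≤ 102 / 100 * M' := by
    rw [← mul_div_assoc, le_div_iff₀ t1] at d4; exact d4
  -- The masses cancel in length times angle, leaving the reciprocal node up to a constant: `1.05 ·
  -- 1.02 < 1.1` and `0.96 · 0.95 > 0.9`.
  have hb1 : a * δ * T ≤ 11 / 10 := by
    have : (a * M) * (L * δ * T) ≤ (105 / 100 * L) * (102 / 100 * M) :=
      mul_le_mul l2 f2 (by positivity) (by positivity)
    have h2 : (a * δ * T) * (L * M) ≤ 11 / 10 * (L * M) := by nlinarith [mul_pos hl m2]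
    exact le_of_mul_le_mul_right h2 (by positivity)
  have hb2 : 9 / 10 ≤ a' * δ' * T' := by
    have : (96 / 100 * L) * (95 / 100 * M') ≤ (a' * M') * (L * δ' * T') :=
      mul_le_mul l3 f3 (by positivity) (by positivity)
    have h2 : 9 / 10 * (L * M') ≤ (a' * δ' * T') * (L * M') := by nlinarith [mul_pos hl m1]
    exact le_of_mul_le_mul_right h2 (by positivity)
  refine ⟨?_, ?_, ?_⟩
  · rw [gt_iff_lt, lt_div_iff₀ e2]
    refine lt_of_mul_lt_mul_left ?_ hl.le
    have hω : 0 < M' / T' := by positivity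
    have h3 : ϰ * (L * δ') ≤ ϰ * (102 / 100 * (M' / T')) :=
      mul_le_mul_of_nonneg_left d4 (by linarith)
    have h4 : 0 < ϰ * (M' / T') := by positivity
    linarith
  · rw [gt_iff_lt, lt_div_iff₀ (by positivity)]
    refine lt_of_mul_lt_mul_right ?_ t1.le
    have h3 : (a * δ) * (lam * T') ≤ (a * δ) * T :=
      mul_le_mul_of_nonneg_left g1.le (by positivity)
    linarith
  · rw [gt_iff_lt, lt_div_iff₀ (by positivity), ← div_eq_mul_inv, div_mul_eq_mul_div,
      div_lt_iff₀ hθ]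
    rw [← mul_div_assoc, div_lt_div_iff₀ (by positivity) (by positivity)] at g3
    have h3 : (a * δ * T) * (L * δ * T) ≤ 11 / 10 * (102 / 100 * M) :=
      mul_le_mul hb1 f2 (by positivity) (by norm_num)
    have h4 : 9 / 10 * (95 / 100 * M') ≤ (a' * δ' * T') * (L * δ' * T') :=
      mul_le_mul hb2 f3 (by positivity) (by positivity)
    have h5 : (a * δ * T) * (L * δ * T) * T' ^ 2 ≤ 11 / 10 * (102 / 100 * M) * T' ^ 2 :=
      mul_le_mul_of_nonneg_right h3 (by positivity)
    have h6 : 9 / 10 * (95 / 100 * M') * (θ * T ^ 2) ≤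
        (a' * δ' * T') * (L * δ' * T') * (θ * T ^ 2) :=
      mul_le_mul_of_nonneg_right h4 (by positivity)
    have h7 : 0 < M * T' ^ 2 := by positivity
    have h8 : 1 / 1000 * (a * δ ^ 2) * (L * T ^ 2 * T' ^ 2) <
        a' * δ' ^ 2 * θ * (L * T ^ 2 * T' ^ 2) := by
      have h9 : 0 < a' * δ' ^ 2 * θ * (L * T ^ 2 * T' ^ 2) := by positivity
      nlinarith
    exact lt_of_mul_lt_mul_right h8 (by positivity)

end IsCanonicalSystemOf

/-- `q_1` is the mean of the probability measure, so it is at most the largest node `t_N`, and `m_N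
≤ 1`. -/
theorem IsJacobiOf.diag_one_bounds {N : ℕ} [NeZero N] {lam ϰ θ : ℝ} {t m q ρ : ℕ → ℝ}
    (h : IsJacobiOf N t m q ρ) (hμ : CompletelyLacunary N lam ϰ θ t m) (hlam : 1000 < lam) :
    0 < q 1 ∧ q 1 * (m N / t N) ≤ 1 := by
  have hN : 1 ≤ N := NeZero.one_le
  have htN := hμ.node_pos N hN le_rfl
  rw [h.diag_one_eq]
  refine ⟨Finset.sum_pos (fun k hk => ?_) ⟨1, by simp [hN]⟩, ?_⟩
  · rw [Finset.mem_Icc] at hk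
    exact mul_pos (hμ.mass_pos k hk.1 hk.2) (hμ.node_pos k hk.1 hk.2)
  · have h1 : ∑ k ∈ Finset.Icc 1 N, m k * t k ≤ t N := by
      calc _ ≤ ∑ k ∈ Finset.Icc 1 N, m k * t N := by
            refine Finset.sum_le_sum fun k hk => ?_
            rw [Finset.mem_Icc] at hk
            refine mul_le_mul_of_nonneg_left ?_ (hμ.mass_pos k hk.1 hk.2).le
            rcases hk.2.eq_or_lt with rfl | hk'
            · rfl
            · have := mul_le_of_growth (by norm_num) hμ.node_pos (hμ.thousand_mul_node_le hlam)
                hk.1 hk' le_rfl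
              linarith [hμ.node_pos k hk.1 hk.2]
        _ = _ := by rw [← Finset.sum_mul, h.total_mass, one_mul]
    have h2 : m N ≤ 1 := by
      rw [← h.total_mass]
      refine Finset.single_le_sum (f := m) (fun k hk => ?_) (Finset.mem_Icc.2 ⟨hN, le_rfl⟩)
      rw [Finset.mem_Icc] at hk
      exact (hμ.mass_pos k hk.1 hk.2).le
    calc _ ≤ t N * (m N / t N) :=
          mul_le_mul_of_nonneg_right h1 (hμ.ratio_pos N hN le_rfl).le
      _ = m N := by field_simp
      _ ≤ 1 := h2

/-! ### Hamiltonian with given lengths and directions -/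

theorem rankOne_ne_of_det_ne_zero {e e' : Plane} (h : e 1 * e' 0 - e 0 * e' 1 ≠ 0) :
    rankOne e ≠ rankOne e' := by
  intro heq
  have h00 : e 0 * e 0 = e' 0 * e' 0 := congrFun (congrFun heq 0) 0
  have h01 : e 0 * e 1 = e' 0 * e' 1 := congrFun (congrFun heq 0) 1
  have h11 : e 1 * e 1 = e' 1 * e' 1 := congrFun (congrFun heq 1) 1
  apply h
  have : (e 1 * e' 0 - e 0 * e' 1) ^ 2 = 0 := by
    linear_combination (e' 0) ^ 2 * h11 + (e' 1) ^ 2 * h00 - 2 * e' 0 * e' 1 * h01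
  exact pow_eq_zero_iff (two_ne_zero) |>.1 this

/-- Otherwise `I ∩ V` would be nonempty and open, hence not null, with two different values of `H`
on it. -/
theorem notMem_of_mem_closure {H : ℝ → Matrix (Fin 2) (Fin 2) ℝ} {I V : Set ℝ}
    {R R' : Matrix (Fin 2) (Fin 2) ℝ} (hI : IsOpen I)
    (hR : ∀ᵐ x ∂(MeasureTheory.volume.restrict I), H x = R) (hV : IsOpen V)
    (hR' : ∀ x ∈ V, H x = R') (hne : R ≠ R') {b : ℝ} (hb : b ∈ closure V) : b ∉ I := by
  intro hbI
  have hn : (I ∩ V).Nonempty := mem_closure_iff.1 hb I hI hbI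
  rw [MeasureTheory.ae_restrict_iff' hI.measurableSet] at hR
  have h3 : ∀ᵐ x ∂(MeasureTheory.volume : MeasureTheory.Measure ℝ), x ∉ I ∩ V := by
    filter_upwards [hR] with x hx hxI
    exact hne ((hx hxI.1).symm.trans (hR' x hxI.2))
  exact ((hI.inter hV).measure_pos MeasureTheory.volume hn).ne'
    (MeasureTheory.measure_eq_zero_iff_ae_notMem.2 h3)

/-- The right end of the interval number `k` in a chain of intervals of lengths `l`. -/
noncomputable def chainEnd (l : ℕ → ℝ) (k : ℕ) : ℝ := ∑ i ∈ Finset.Icc 1 k, l i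

/-- The number of intervals of a chain which lie to the left of `x`. -/
noncomputable def chainCount (N : ℕ) (l : ℕ → ℝ) (x : ℝ) : ℕ :=
  ∑ k ∈ Finset.Icc 1 N, if chainEnd l k ≤ x then 1 else 0

theorem measurable_chainCount (N : ℕ) (l : ℕ → ℝ) : Measurable (chainCount N l) := by
  unfold chainCount
  refine Finset.measurable_sum _ fun k _ => ?_
  exact Measurable.ite measurableSet_Ici measurable_const measurable_const

section Chain

variable {N : ℕ} {l : ℕ → ℝ} {e : ℕ → Plane}

theorem chainEnd_succ (k : ℕ) : chainEnd l (k + 1) = chainEnd l k + l (k + 1) := by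
  rw [chainEnd, Finset.sum_Icc_succ_top (by omega)]; rfl

theorem chainEnd_mono (hl : ∀ k, 1 ≤ k → k ≤ N → 0 < l k) {i j : ℕ} (hij : i ≤ j) (hj : j ≤ N) :
    chainEnd l i ≤ chainEnd l j := by
  induction j, hij using Nat.le_induction with
  | base => rfl
  | succ j hij ih =>
    rw [chainEnd_succ]
    linarith [ih (by omega), hl (j + 1) (by omega) hj]

theorem chainCount_eq (hl : ∀ k, 1 ≤ k → k ≤ N → 0 < l k) {n : ℕ} (hn : n ≤ N) {x : ℝ}
    (h1 : chainEnd l n ≤ x) (h2 : n < N → x < chainEnd l (n + 1)) : chainCount N l x = n := by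
  rw [chainCount, ← Finset.card_filter]
  have : (Finset.Icc 1 N).filter (fun k => chainEnd l k ≤ x) = Finset.Icc 1 n := by
    ext k
    simp only [Finset.mem_filter, Finset.mem_Icc]
    constructor
    · rintro ⟨⟨h3, h4⟩, h5⟩
      refine ⟨h3, ?_⟩
      by_contra hk
      have := chainEnd_mono hl (show n + 1 ≤ k by omega) h4
      linarith [h2 (by omega)]
    · rintro ⟨h3, h4⟩
      exact ⟨⟨h3, by omega⟩, (chainEnd_mono hl h4 hn).trans h1⟩
  rw [this]; simp

/-- A strictly larger interval would contain a division point, where the matrices on the two sides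
differ, or the point `0`, which lies outside the half-line. -/
theorem isIndivisibleChain_of_unit (hl : ∀ k, 1 ≤ k → k ≤ N → 0 < l k)
    (he : ∀ k, 1 ≤ k → e k 0 ^ 2 + e k 1 ^ 2 = 1)
    (hd : ∀ k, 1 ≤ k → k ≤ N → chainDelta e k ≠ 0) :
    IsIndivisibleChain N (fun x => rankOne (e (chainCount N l x + 1))) l e := by
  have hne : ∀ k, 1 ≤ k → k ≤ N → rankOne (e k) ≠ rankOne (e (k + 1)) := by
    intro k h1 hk
    apply rankOne_ne_of_det_ne_zero
    rw [← chainDelta_eq]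
    exact hd k h1 hk
  have hin : ∀ n, n < N → ∀ x ∈ Set.Ioo (chainEnd l n) (chainEnd l (n + 1)),
      rankOne (e (chainCount N l x + 1)) = rankOne (e (n + 1)) := by
    intro n hn x hx
    rw [chainCount_eq hl hn.le hx.1.le (fun _ => hx.2)]
  have hlast : ∀ x ∈ Set.Ioi (chainEnd l N),
      rankOne (e (chainCount N l x + 1)) = rankOne (e (N + 1)) := by
    intro x hx
    rw [chainCount_eq hl le_rfl (le_of_lt hx) (fun h => absurd h (lt_irrefl _))]
  have h0 : chainEnd l 0 = 0 := by simp [chainEnd]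
  have hlt : ∀ n, n < N → chainEnd l n < chainEnd l (n + 1) := by
    intro n hn
    rw [chainEnd_succ]
    linarith [hl (n + 1) (by omega) hn]
  have hnonneg : ∀ n, n ≤ N → 0 ≤ chainEnd l n := fun n hn =>
    h0 ▸ chainEnd_mono hl (Nat.zero_le n) hn
  -- no interval of constancy contains a point of division
  have hdiv : ∀ n, n < N → ∀ I' : Set ℝ, IsOpen I' →
      ((∀ᵐ x ∂(MeasureTheory.volume.restrict I'),
        rankOne (e (chainCount N l x + 1)) = rankOne (e (n + 1))) ∨
       (∀ᵐ x ∂(MeasureTheory.volume.restrict I'),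
        rankOne (e (chainCount N l x + 1)) = rankOne (e (n + 2)))) →
      chainEnd l (n + 1) ∉ I' := by
    intro n hn I' hI' hor
    rcases hor with hor | hor
    · rcases Nat.lt_or_ge (n + 1) N with hn' | hn'
      · refine notMem_of_mem_closure hI' hor isOpen_Ioo (hin (n + 1) hn')
          (hne (n + 1) (by omega) hn) ?_
        rw [closure_Ioo (hlt _ hn').ne]
        exact Set.left_mem_Icc.2 (hlt _ hn').le
      · have : N = n + 1 := by omega
        subst this
        refine notMem_of_mem_closure hI' hor isOpen_Ioi hlast
          (hne (n + 1) (by omega) hn) ?_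
        rw [closure_Ioi]
        exact Set.self_mem_Ici
    · refine notMem_of_mem_closure hI' hor isOpen_Ioo (hin n hn)
          (hne (n + 1) (by omega) hn).symm ?_
      rw [closure_Ioo (hlt _ hn).ne]
      exact Set.right_mem_Icc.2 (hlt _ hn).le
  refine ⟨⟨?_, ?_, ?_⟩, hl, ?_, ?_⟩
  · intro i j
    refine MeasureTheory.LocallyIntegrable.locallyIntegrableOn ?_ _
    refine (MeasureTheory.locallyIntegrable_const (1 : ℝ)).mono ?_ ?_
    · have : Measurable fun n : ℕ => rankOne (e (n + 1)) i j := measurable_of_countable _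
      exact (this.comp (measurable_chainCount N l)).aestronglyMeasurable
    · refine Eventually.of_forall fun x => ?_
      have h1 := he (chainCount N l x + 1) (by omega)
      set v := e (chainCount N l x + 1)
      have h2 : ∀ i, |v i| ≤ 1 := by
        intro i
        rw [← sq_le_one_iff_abs_le_one]
        fin_cases i
        · simp only [Fin.zero_eta]; nlinarith [sq_nonneg (v 1)]
        · simp only [Fin.mk_one]; nlinarith [sq_nonneg (v 0)]
      simp only [rankOne, Matrix.of_apply, Real.norm_eq_abs, abs_mul, abs_one]
      exact mul_le_one₀ (h2 i) (abs_nonneg _) (h2 j)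
  · refine Eventually.of_forall fun x => ?_
    have := Matrix.posSemidef_vecMulVec_self_star (R := ℝ) (n := Fin 2)
      (fun i => e (chainCount N l x + 1) i)
    convert this using 1
    ext i j
    simp [rankOne, Matrix.vecMulVec]
  · refine Eventually.of_forall fun x => ?_
    have h1 := he (chainCount N l x + 1) (by omega)
    simp only [Matrix.trace_fin_two, rankOne, Matrix.of_apply]
    linarith
  · intro k h1 hk
    obtain ⟨n, rfl⟩ := Nat.exists_eq_add_of_le' h1
    change IsIndivisible _ (Set.Ioo (chainEnd l (n + 1 - 1)) (chainEnd l (n + 1))) _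
    rw [Nat.add_sub_cancel]
    have hne' := Set.nonempty_Ioo.2 (hlt n hk)
    refine ⟨hne', isOpen_Ioo, Set.ordConnected_Ioo, ?_, hin n hk, ?_⟩
    · intro x hx; exact lt_of_le_of_lt (hnonneg n (by omega)) hx.1
    · intro I' hI' hoc hpos hsub hae
      refine Set.Subset.antisymm (fun x hx => ?_) hsub
      obtain ⟨c, hc⟩ := hne'
      refine ⟨?_, ?_⟩
      · by_contra! hx'
        have hmem : chainEnd l n ∈ I' := hoc.out hx (hsub hc) ⟨hx', hc.1.le⟩
        rcases Nat.eq_zero_or_pos n with rfl | hn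
        · rw [h0] at hmem
          exact lt_irrefl (0 : ℝ) (Set.mem_Ioi.1 (hpos hmem))
        · obtain ⟨n, rfl⟩ := Nat.exists_eq_add_of_le' hn
          exact hdiv n (by omega) I' hI' (Or.inr hae) hmem
      · by_contra! hx'
        exact hdiv n hk I' hI' (Or.inl hae) (hoc.out (hsub hc) hx ⟨hc.2.le, hx'⟩)
  · change IsIndivisible _ (Set.Ioi (chainEnd l N)) _
    refine ⟨Set.nonempty_Ioi, isOpen_Ioi, Set.ordConnected_Ioi, ?_, hlast, ?_⟩
    · intro x hx; exact lt_of_le_of_lt (hnonneg N le_rfl) hx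
    · intro I' hI' hoc hpos hsub hae
      refine Set.Subset.antisymm (fun x hx => ?_) hsub
      obtain ⟨c, hc⟩ : (Set.Ioi (chainEnd l N)).Nonempty := Set.nonempty_Ioi
      by_contra hx'
      have hmem : chainEnd l N ∈ I' :=
        hoc.out hx (hsub hc) ⟨not_lt.1 hx', le_of_lt hc⟩
      rcases Nat.eq_zero_or_pos N with hN | hN
      · rw [hN, h0] at hmem
        exact lt_irrefl (0 : ℝ) (Set.mem_Ioi.1 (hpos hmem))
      · obtain ⟨n, rfl⟩ := Nat.exists_eq_add_of_le' hN
        exact hdiv n (by omega) I' hI' (Or.inr hae) hmem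

end Chain

/-! ### Existence of a corresponding canonical system -/

/-- The solution of the alternating-sign Jacobi recurrence with prescribed initial values. -/
noncomputable def jacobiSolution (q r : ℕ → ℝ) (a b : ℝ) : ℕ → ℝ
  | 0 => a
  | 1 => b
  | n + 2 => -(q (n + 1) * jacobiSolution q r a b (n + 1) + r n * jacobiSolution q r a b n) /
      r (n + 1)

theorem jacobiSolution_succ_succ {q r : ℕ → ℝ} (hr : ∀ j, r j ≠ 0) (a b : ℝ) (n : ℕ) :
    r (n + 1) * jacobiSolution q r a b (n + 2) =
      -(q (n + 1) * jacobiSolution q r a b (n + 1) + r n * jacobiSolution q r a b n) := by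
  rw [jacobiSolution, mul_div_cancel₀ _ (hr _)]

theorem jacobiSolution_wronskian {q r : ℕ → ℝ} (hr : ∀ j, r j ≠ 0) (a b a' b' : ℝ) (n : ℕ) :
    r n * (jacobiSolution q r a b n * jacobiSolution q r a' b' (n + 1) -
      jacobiSolution q r a' b' n * jacobiSolution q r a b (n + 1)) = r 0 * (a * b' - a' * b) := by
  induction n with
  | zero => simp [jacobiSolution]
  | succ n ih =>
    have h1 := jacobiSolution_succ_succ (q := q) hr a b n
    have h2 := jacobiSolution_succ_succ (q := q) hr a' b' n
    linear_combination jacobiSolution q r a b (n + 1) * h2 -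
      jacobiSolution q r a' b' (n + 1) * h1 + ih

/-- Take solutions `x`, `y` of the recurrence with Wronskian `1` and put `l = x² + y²`, `e = (x, y)
/ √l`. The Wronskian yields the signs and the off-diagonal formula, the recurrence yields the
diagonal one. -/
theorem exists_isCanonicalSystemOf {N : ℕ} {q ρ : ℕ → ℝ}
    (hρ : ∀ j, 1 ≤ j → j < N → 0 < ρ j) (hq : 0 < q 1) :
    ∃ (H : ℝ → Matrix (Fin 2) (Fin 2) ℝ) (l : ℕ → ℝ) (e : ℕ → Plane),
      IsCanonicalSystemOf N q ρ H l e := by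
  set r := extendByOne N ρ with hrdef
  have hrpos : ∀ j, 0 < r j := extendByOne_pos hρ
  have hr : ∀ j, r j ≠ 0 := fun j => (hrpos j).ne'
  have hr0 : r 0 = 1 := by simp [hrdef, extendByOne]
  set L : ℝ := 1000 / q 1 with hL
  have hLpos : 0 < L := by positivity
  have hsL : √L ≠ 0 := (Real.sqrt_pos.2 hLpos).ne'
  -- The values at `1` encode `e_1 = (1, 0)` and `l_1 = L`; those at `0` make the Wronskian `1` and
  -- the cotangent number `0` vanish, so that the general diagonal formula covers `q_1`.
  set x := jacobiSolution q r 0 √L with hx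
  set y := jacobiSolution q r (1 / √L) 0 with hy
  have hW : ∀ n, r n * (y n * x (n + 1) - x n * y (n + 1)) = 1 := by
    intro n
    have := jacobiSolution_wronskian (q := q) hr (1 / √L) 0 0 √L n
    rw [hr0] at this
    rw [hx, hy, this]
    field_simp; ring
  have hxrec : ∀ n, r (n + 1) * x (n + 2) = -(q (n + 1) * x (n + 1) + r n * x n) :=
    jacobiSolution_succ_succ hr _ _
  have hyrec : ∀ n, r (n + 1) * y (n + 2) = -(q (n + 1) * y (n + 1) + r n * y n) :=
    jacobiSolution_succ_succ hr _ _
  have hx1 : x 1 = √L := by simp [hx, jacobiSolution]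
  have hy1 : y 1 = 0 := by simp [hy, jacobiSolution]
  have hx0 : x 0 = 0 := by simp [hx, jacobiSolution]
  clear_value x y
  set l : ℕ → ℝ := fun n => x n ^ 2 + y n ^ 2 with hl
  have hlpos : ∀ n, 0 < l n := by
    intro n
    have h0 : 0 ≤ l n := by simp only [hl]; positivity
    refine lt_of_le_of_ne h0 fun h => ?_
    have hxn : x n = 0 := by
      have : x n ^ 2 = 0 := by simp only [hl] at h; nlinarith [sq_nonneg (x n), sq_nonneg (y n)]
      exact pow_eq_zero_iff two_ne_zero |>.1 this
    have hyn : y n = 0 := by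
      have : y n ^ 2 = 0 := by simp only [hl] at h; nlinarith [sq_nonneg (x n), sq_nonneg (y n)]
      exact pow_eq_zero_iff two_ne_zero |>.1 this
    have := hW n
    rw [hxn, hyn] at this
    simp at this
  have hspos : ∀ n, 0 < √(l n) := fun n => Real.sqrt_pos.2 (hlpos n)
  have hsq : ∀ n, √(l n) * √(l n) = x n ^ 2 + y n ^ 2 := fun n => Real.mul_self_sqrt (hlpos n).le
  set e : ℕ → Plane := fun n => !₂[x n / √(l n), y n / √(l n)] with he
  have e0 : ∀ n, e n 0 = x n / √(l n) := fun n => by simp [he]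
  have e1 : ∀ n, e n 1 = y n / √(l n) := fun n => by simp [he]
  have hδ : ∀ n, chainDelta e n = 1 / (r n * (√(l n) * √(l (n + 1)))) := by
    intro n
    have h1 := (hspos n).ne'
    have h2 := (hspos (n + 1)).ne'
    have h3 := hr n
    rw [chainDelta_eq, e0, e1, e0, e1]
    field_simp
    linear_combination hW n
  have hδpos : ∀ n, 0 < chainDelta e n := fun n => by
    rw [hδ]
    exact one_div_pos.2 (mul_pos (hrpos n) (mul_pos (hspos n) (hspos (n + 1))))
  have hcot : ∀ n, chainCot e n = -(r n * (x n * x (n + 1) + y n * y (n + 1))) := by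
    intro n
    have h1 := chainCot_mul_chainDelta (hδpos n)
    have h2 := (hspos n).ne'
    have h3 := (hspos (n + 1)).ne'
    have h4 := hr n
    rw [hδ, e0, e1, e0, e1] at h1
    field_simp at h1
    linarith
  have hdiag : ∀ n, chainCot e (n + 1) + chainCot e n = q (n + 1) * l (n + 1) := by
    intro n
    rw [hcot, hcot]
    simp only [hl]
    linear_combination (-x (n + 1)) * hxrec n - y (n + 1) * hyrec n
  have hl1 : l 1 = L := by simp [hl, hx1, hy1, Real.sq_sqrt hLpos.le]
  refine ⟨_, l, e, isIndivisibleChain_of_unit (fun k _ _ => hlpos k) (fun k _ => ?_)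
    (fun k _ _ => (hδpos k).ne'), ⟨?_, ?_, ?_, fun k _ _ => hδpos k⟩, ?_, hl1⟩
  · rw [e0, e1]
    have h1 := (hspos k).ne'
    have h2 := hsq k
    field_simp
    linear_combination -h2
  · have h1 := hdiag 0
    have h2 : chainCot e 0 = 0 := by rw [hcot, hx0, hy1]; ring
    have h3 : e 1 1 = 0 := by rw [e1, hy1, zero_div]
    have h4 := (hlpos 1).ne'
    rw [h2] at h1
    simp only [zero_add, add_zero] at h1
    rw [h3, h1]
    field_simp
    ring
  · intro j hj hjN
    obtain ⟨n, rfl⟩ := Nat.exists_eq_add_of_le' (show 1 ≤ j by omega)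
    rw [Nat.add_sub_cancel, hdiag]
    have h4 := (hlpos (n + 1)).ne'
    field_simp
  · intro j hj hjN
    have h1 : inner ℝ (perp (e j)) (e (j + 1)) = -chainDelta e j := by rw [chainDelta, neg_neg]
    have h2 := (hspos j).ne'
    have h3 := (hspos (j + 1)).ne'
    have h4 := hr j
    rw [h1, hδ, Real.sqrt_mul (hlpos _).le, ← extendByOne_of_lt (N := N) (ρ := ρ) hj hjN, ← hrdef]
    field_simp
  · ext i
    fin_cases i
    · simp [e0, hl1, hx1, hsL]
    · simp [e1, hy1]

theorem theorem4 (N : ℕ) [NeZero N] (lam ϰ θ : ℝ)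
    (hlam : 1000 < lam) (hϰ : 100 < ϰ) (hθ₁ : 10 / lam < θ) (hθ₂ : θ < 1 / 100)
    (t m q ρ : ℕ → ℝ)
    (hμ : CompletelyLacunary N lam ϰ θ t m)
    (hJ : IsJacobiOf N t m q ρ) :
    (∃ (H : ℝ → Matrix (Fin 2) (Fin 2) ℝ) (l : ℕ → ℝ) (e : ℕ → Plane),
      IsCanonicalSystemOf N q ρ H l e) ∧
    ∀ (H : ℝ → Matrix (Fin 2) (Fin 2) ℝ) (l : ℕ → ℝ) (e : ℕ → Plane),
      IsCanonicalSystemOf N q ρ H l e →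
        (1 / 1001 < chainDelta e 1 ∧ chainDelta e 1 < 1 / 1000) ∧
        ∀ n, 1 ≤ n → n < N →
          chainDelta e n / chainDelta e (n + 1) > 1 / 10 * ϰ ∧
          l (n + 1) * chainDelta e (n + 1) / (l n * chainDelta e n) > 1 / 10 * lam ∧
          l (n + 1) * chainDelta e (n + 1) ^ 2 / (l n * chainDelta e n ^ 2) > 1 / 1000 * θ⁻¹ := by
  have ho := hJ.isOrthoSystem hμ.mass_pos
  have hN : 1 ≤ N := NeZero.one_le
  obtain ⟨hq, hqm⟩ := hJ.diag_one_bounds hμ hlam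
  have hθ : 0 < θ := lt_trans (div_pos (by norm_num) (by linarith)) hθ₁
  refine ⟨exists_isCanonicalSystemOf hJ.offdiag_pos hq, fun H l e h => ⟨?_, fun n h1 hn =>
    h.lacunary_bounds ho hμ hlam hϰ hθ hq hqm h1 hn⟩⟩
  have h1 := h.sq_chainDelta_one hN hq.ne'
  have h2 := h.corresponds.sign 1 le_rfl hN
  -- `1000² < 1000001 < 1001²`.
  constructor <;> nlinarith
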